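/- Let $p$ be a prime, $G$ a finite group, $N\trianglelefteq G$ a normal subgroup, and let $b\in\mathrm{Bl}(N)$ be a $p$-block of $N$ with a defect group $D$ such that $D\,C_G(D)=G$. Let $\theta\in\mathrm{Irr}(b)$, and assume that $\theta$ extends to $G$, i.e. there is $\tilde\theta\in\mathrm{Irr}(G)$ with $\tilde\theta_N=\theta$. For a finite group $X$, write $\mathrm{Irr}(X)$ for its set of irreducible complex characters, $\mathrm{Bl}(X)$ for its set of $p$-blocks (always formed with respect to one fixed maximal ideal, containing $p$, of the ring of algebraic integers in $\mathbb C$), and $\mathrm{bl}(\chi)$ for the $p$-block containing $\chi\in\mathrm{Irr}(X)$; for $\bar\eta\in\mathrm{Irr}(G/N)$ let $\eta\in\mathrm{Irr}(G)$ be its lift, $\eta(g)=\bar\eta(gN)$. Let $\mathrm{Bl}(G\mid b)$ be the set of $p$-blocks of $G$ covering $b$, i.e. of those blocks $B$ for which there are $\chi\in\mathrm{Irr}(B)$ and $\psi\in\mathrm{Irr}(b)$ such that $\psi$ is a constituent of $\chi_N$. Then for every $\bar\eta\in\mathrm{Irr}(G/N)$ the product $\tilde\theta\eta$ is an irreducible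 character of $G$, and the map $$\upsilon:\mathrm{Bl}(G/N)\to\mathrm{Bl}(G\mid b),\qquad \mathrm{bl}(\bar\eta)\mapsto\mathrm{bl}(\tilde\theta\eta),$$ is well defined and is a bijection. -/

import Mathlib

/-! Ordinary characters, `p`-blocks, defect groups and covering of blocks of finite groups.
Throughout, `M` is a maximal ideal, containing the prime `p`, of the ring of all algebraic
integers in `ℂ`. It is fixed once and for all, as is standard in block theory. -/

namespace BlockTheory

/-- The ring of all algebraic integers in `ℂ`. -/
abbrev AlgInt : Type := integralClosure ℤ ℂ

/-- `Irr(G)`: the characters of the irreducible complex representations of `G`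
(finite-dimensional, so without loss of generality on some `ℂⁿ`). -/
abbrev Irr (G : Type*) [Group G] : Type _ :=
  {χ : G → ℂ // ∃ (n : ℕ) (ρ : Representation ℂ G (Fin n → ℂ)),
    ρ.IsIrreducible ∧ ρ.character = χ}

instance instCoeFunIrr (G : Type*) [Group G] : CoeFun (Irr G) (fun _ => G → ℂ) := ⟨Subtype.val⟩

/-- The value `ω_χ(K⁺) = |K| χ(g) / χ(1)` of the central character of `χ` at the sum of the
conjugacy class `K` of `g`. It is an algebraic integer. -/
noncomputable def centralChar {G : Type*} [Group G] (χ : Irr G) (g : G) : ℂ :=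
  (Nat.card (conjugatesOf g) : ℂ) * χ g / χ 1

/-- `χ` and `ψ` lie in the same block: `λ_χ(K⁺) = λ_ψ(K⁺)` for every conjugacy class `K`, where
`λ_χ(K⁺)` is the residue class of the algebraic integer `ω_χ(K⁺)` modulo `M`. -/
def blockSetoid (M : Ideal AlgInt) (G : Type*) [Group G] : Setoid (Irr G) where
  r χ ψ := ∀ g : G, ∃ m ∈ M, (m : ℂ) = centralChar χ g - centralChar ψ g
  iseqv :=
    { refl := fun _ _ => ⟨0, M.zero_mem, by simp⟩
      symm := fun h g => by
        obtain ⟨m, hm, e⟩ := h g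
        exact ⟨-m, M.neg_mem hm, by push_cast; rw [e]; ring⟩
      trans := fun h k g => by
        obtain ⟨m, hm, e⟩ := h g
        obtain ⟨n, hn, f⟩ := k g
        exact ⟨m + n, M.add_mem hm hn, by push_cast; rw [e, f]; ring⟩ }

/-- `Bl(G)`: the set of blocks of `G`. A block is given by its set of ordinary irreducible
characters (every block contains one, and these sets partition `Irr(G)`). -/
def Bl (M : Ideal AlgInt) (G : Type*) [Group G] : Type _ := Quotient (blockSetoid M G)

/-- `bl(χ)`: the block containing `χ`. -/
def bl (M : Ideal AlgInt) {G : Type*} [Group G] (χ : Irr G) : Bl M G :=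
  Quotient.mk (blockSetoid M G) χ

/-- The coefficient at `g` of the sum `∑_{χ ∈ Irr(B)} e_χ` of the central idempotents
`e_χ = |G|⁻¹ ∑_x χ(1) χ(x⁻¹) x` of `ℂG`. All these coefficients lie in the localization of the
algebraic integers at `M`, and their residue classes are the coefficients `a_B(K⁺)` of the block
idempotent `e_B = ∑_K a_B(K⁺) K⁺`. (`Irr G` is finite, see `finite_irr`.) -/
noncomputable def idempotentCoeff {M : Ideal AlgInt} {G : Type*} [Group G] (B : Bl M G)
    (g : G) : ℂ :=
  (Nat.card G : ℂ)⁻¹ * ∑ᶠ (χ : Irr G) (_ : bl M χ = B), χ 1 * χ g⁻¹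

/-- The conjugacy class `K` of `g` is a defect class of `B`: both `λ_B(K⁺)` and `a_B(K⁺)` are
nonzero. The first says that the algebraic integer `ω_χ(K⁺)`, for `χ` in `B`, is outside `M`;
the second that the coefficient of `∑ e_χ` at `g` is a unit of the localization at `M`. -/
def IsDefectClass {M : Ideal AlgInt} {G : Type*} [Group G] (B : Bl M G) (g : G) : Prop :=
  (∃ χ : Irr G, bl M χ = B ∧ ∃ r : AlgInt, r ∉ M ∧ (r : ℂ) = centralChar χ g) ∧
  (∃ r s : AlgInt, r ∉ M ∧ s ∉ M ∧ idempotentCoeff B g * (s : ℂ) = (r : ℂ))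

/-- `D` is a defect group of `B`: a Sylow `p`-subgroup of `C_G(g)` for some element `g` of a
defect class of `B`. -/
def IsDefectGroup (p : ℕ) {M : Ideal AlgInt} {G : Type*} [Group G] (B : Bl M G)
    (D : Subgroup G) : Prop :=
  ∃ g : G, IsDefectClass B g ∧ ∃ P : Sylow p (Subgroup.centralizer ({g} : Set G)),
    D = P.toSubgroup.map (Subgroup.centralizer ({g} : Set G)).subtype

/-- The scalar product `[χ_N, θ] = |N|⁻¹ ∑_{n ∈ N} χ(n) θ(n⁻¹)`. -/
noncomputable def resInner {G : Type*} [Group G] {N : Subgroup G} (χ : Irr G) (θ : Irr N) : ℂ :=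
  (Nat.card N : ℂ)⁻¹ * ∑ᶠ n : N, χ (n : G) * θ n⁻¹

/-- `B` covers `b`: some `χ ∈ Irr(B)` has a constituent of its restriction to `N` in `b`. -/
def Covers {M : Ideal AlgInt} {G : Type*} [Group G] {N : Subgroup G} (B : Bl M G)
    (b : Bl M N) : Prop :=
  ∃ (χ : Irr G) (θ : Irr N), bl M χ = B ∧ bl M θ = b ∧ resInner χ θ ≠ 0

/-- The complex irreducible characters of a finite group are finite in number. -/
theorem finite_irr (G : Type*) [Group G] [Finite G] : Finite (Irr G) := by
  classical
  have := Fintype.ofFinite G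
  let _ : Invertible (Nat.card G : ℂ) :=
    invertibleOfNonzero (Nat.cast_ne_zero.mpr Nat.card_pos.ne')
  have key : ∀ χ ψ : Irr G, (Nat.card G : ℂ)⁻¹ * ∑ g : G, χ g * ψ g⁻¹ =
      if χ = ψ then 1 else 0 := by
    rintro ⟨χ, n, ρ, hρ, rfl⟩ ⟨ψ, m, σ, hσ, rfl⟩
    have h := Representation.char_orthonormal ρ σ
    by_cases he : Nonempty (Representation.Equiv σ ρ)
    · have e : ρ.character = σ.character := (Representation.char_iso he.some).symm
      rw [if_pos he] at h
      rw [if_pos (Subtype.ext e)]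
      exact h
    · rw [if_neg he] at h
      have hne : ρ.character ≠ σ.character := by
        intro e
        have h' := Representation.char_orthonormal σ σ
        rw [if_pos ⟨Representation.Equiv.refl _⟩, ← e] at h'
        rw [← e, h'] at h
        exact one_ne_zero h
      rw [if_neg (fun e => hne (congrArg Subtype.val e))]
      exact h
  have hli : LinearIndependent ℂ (fun χ : Irr G => (χ : G → ℂ)) := by
    rw [linearIndependent_iff']
    intro s c hc ψ hψ
    have h0 : (Nat.card G : ℂ)⁻¹ * ∑ g : G, (∑ χ ∈ s, c χ • (χ : G → ℂ)) g * ψ g⁻¹ = 0 := by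
      rw [hc]; simp
    have h1 : (Nat.card G : ℂ)⁻¹ * ∑ g : G, (∑ χ ∈ s, c χ • (χ : G → ℂ)) g * ψ g⁻¹ =
        ∑ χ ∈ s, c χ * ((Nat.card G : ℂ)⁻¹ * ∑ g : G, χ g * ψ g⁻¹) := by
      simp only [Finset.sum_apply, Pi.smul_apply, smul_eq_mul, Finset.sum_mul, Finset.mul_sum]
      rw [Finset.sum_comm]
      refine Finset.sum_congr rfl fun χ _ => Finset.sum_congr rfl fun g _ => by ring
    rw [h1] at h0
    simp only [key] at h0
    simpa [hψ] using h0
  exact hli.finite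

end BlockTheory

open BlockTheory
open scoped Pointwise

namespace BlockTheory

open scoped Classical

/-! ### Irreducible representations over `ℂ`: Schur's lemma and the norm-one criterion. -/

section Representations

variable {G : Type*} [Group G] {V : Type*} [AddCommGroup V] [Module ℂ V] [FiniteDimensional ℂ V]

/-! Write `C = C_G(D)`, `K = N ∩ C` and `Z = D ∩ C`; since `G = D C`, the group `Z` is central in
`G`. Fix a power `E` of `p` such that `x ^ E` is the `p`-regular part of each `x`. Congruences are
modulo `M`.

The extension `θ'` has norm one on every coset of `N`, so each `θ'η` is irreducible
(`exists_irr_mul`). By Schur's lemma for `θ`, an `N`-invariant element of the integral group ring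
acts on `θ'` by a scalar `ω_θ'`. Evaluating this scalar on the part of a central `z` in each coset
of `N` gives a multiplicative map `quotientHom` into the centre for `G ⧸ N`, with `ω_{θ'η}(z) =
ω_η(quotientHom z)`. Hence `υ` is well defined (`bl_mul_eq_of_bl_eq`).

The rest depends on a number that is invertible modulo `M`. The restriction of `θ'` to `C` is a
multiple of an irreducible character; let `φ` be the corresponding multiple of `θ'`. Then `r = |K| /
(|Z| φ(1))` is an algebraic integer, and it lies outside `M` because `D` is a defect group of `b`
(`card_div_notMem`). It follows that `φ(x) ∈ M` whenever `x ∈ C` has its `p`-part in `N` but not in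
`D` (`mem_coeIdeal_of_notMem`). It also follows that over the `p`-regular elements of a `p`-regular
coset of `N` the sum of `φ(x⁻¹) φ(x) / φ(1)` is congruent to `r` (`sum_regular_sub_mem`).

Injectivity: for `p`-regular `q` in `G ⧸ N`, the sum of `φ(x⁻¹) x` over the `p`-regular `x` lying
over the class of `q` is mapped by `quotientHom` to `r` times the class sum of `q`, up to `M`. So
the block of `θ'η` determines `ω_η` on `p`-regular classes, and these determine the block
(`bl_eq_of_regular`).

Surjectivity: suppose `χ` lies over `b` but in no block of the image. Some central `a` supported on
`p`-regular elements has `ω_χ(a) ∉ M` and all its coset scalars `ω_θ'` in `M`. For `f` the sum of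
`φ(x⁻¹) x` over `p`-regular `x ∈ N`, and `Z⁺` the sum of `Z`, one gets `a f Z⁺ ≡ 0`, then `(a f) ^ E
≡ 0`, then `ω_χ(f) ∈ M`. But `ω_χ(f) ≡ ω_θ(f) ≡ r` (`exists_bl_mul_eq`). -/

theorem eq_smul_one_of_commute (ρ : Representation ℂ G V) [hρ : ρ.IsIrreducible]
    (X : Module.End ℂ V) (hX : ∀ g, Commute X (ρ g)) :
    X = (LinearMap.trace ℂ V X / Module.finrank ℂ V) • (1 : Module.End ℂ V) := by
  let f : Representation.IntertwiningMap ρ ρ :=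
    ⟨X, fun g => LinearMap.ext fun v => LinearMap.congr_fun (hX g).eq v⟩
  obtain ⟨c, hc⟩ :=
    (Representation.IsIrreducible.algebraMap_intertwiningMap_bijective_of_isAlgClosed
      (ρ := ρ)).2 f
  have hX' : X = c • (1 : Module.End ℂ V) := by
    ext v
    have := congrArg (fun h : Representation.IntertwiningMap ρ ρ => h v) hc
    simpa [f, Algebra.algebraMap_eq_smul_one] using this.symm
  have : Nontrivial V := by
    by_contra h
    rw [not_nontrivial_iff_subsingleton] at h
    have := hρ.toNontrivial
    obtain ⟨a, b, hab⟩ := this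
    apply hab
    ext v
    rw [Subsingleton.elim v 0]
    simp
  have hd : (Module.finrank ℂ V : ℂ) ≠ 0 := by
    exact_mod_cast (Module.finrank_pos (R := ℂ) (M := V)).ne'
  rw [hX']
  simp [hd]

/-- Norm one forces all endomorphisms to be scalars. The projection onto a submodule along a Maschke
complement is then a scalar, so the submodule is trivial. -/
theorem isIrreducible_of_sum_character [Fintype G] (ρ : Representation ℂ G V)
    (h : ∑ g, ρ.character g * ρ.character g⁻¹ = Nat.card G) : ρ.IsIrreducible := by
  let _ : Invertible (Nat.card G : ℂ) :=
    invertibleOfNonzero (Nat.cast_ne_zero.mpr Nat.card_pos.ne')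
  have h1 := Representation.card_inv_mul_sum_char_mul_char_eq_finrank ρ ρ
  rw [h, inv_mul_cancel_of_invertible] at h1
  have h2 : Module.finrank ℂ (Representation.IntertwiningMap ρ ρ) = 1 := by exact_mod_cast h1.symm
  rw [Representation.irreducible_iff_isSimpleModule_asModule]
  have h3 : Module.finrank ℂ (Module.End (MonoidAlgebra ℂ G) ρ.asModule) = 1 := by
    rw [← h2]
    exact (LinearEquiv.finrank_eq
      (Representation.IntertwiningMap.equivAlgEnd (ρ := ρ)).toLinearEquiv).symm
  have hnt : Nontrivial ρ.asModule := by
    by_contra hn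
    rw [not_nontrivial_iff_subsingleton] at hn
    have : Subsingleton (Module.End (MonoidAlgebra ℂ G) ρ.asModule) := inferInstance
    rw [Module.finrank_zero_of_subsingleton] at h3
    exact zero_ne_one h3
  rw [isSimpleModule_iff]
  refine { exists_pair_ne := ⟨⊥, ⊤, bot_ne_top⟩, eq_bot_or_eq_top := fun W => ?_ }
  obtain ⟨W', hW⟩ := exists_isCompl W
  obtain ⟨c, hc⟩ := (finrank_eq_one_iff_of_nonzero' (1 : Module.End (MonoidAlgebra ℂ G) ρ.asModule)
    one_ne_zero).mp h3 (W.projection W' hW)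
  by_cases hc0 : c = 0
  · left
    rw [eq_bot_iff]
    intro v hv
    have := LinearMap.congr_fun hc v
    rw [hc0, Submodule.projection_apply_left hW ⟨v, hv⟩] at this
    simpa using this.symm
  · right
    rw [eq_top_iff]
    intro v _
    have := LinearMap.congr_fun hc (c⁻¹ • v)
    have h5 : v = W.projection W' hW (c⁻¹ • v) := by
      rw [← this]
      simp [hc0]
    rw [h5]
    exact Submodule.projection_apply_mem hW _

theorem sum_character_mul_inv [Fintype G] (ρ : Representation ℂ G V) [ρ.IsIrreducible] :
    ∑ g, ρ.character g * ρ.character g⁻¹ = Nat.card G := by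
  let _ : Invertible (Nat.card G : ℂ) :=
    invertibleOfNonzero (Nat.cast_ne_zero.mpr Nat.card_pos.ne')
  have h := Representation.char_orthonormal ρ ρ
  rw [if_pos ⟨Representation.Equiv.refl _⟩,
    inv_mul_eq_one₀ (Nat.cast_ne_zero.mpr Nat.card_pos.ne')] at h
  exact h.symm

/-- `Irr` only admits representations on `ℂⁿ`; a choice of basis moves a representation there
without enlarging its annihilator. -/
theorem exists_conj_fin (ρ : Representation ℂ G V) :
    ∃ ρ' : Representation ℂ G (Fin (Module.finrank ℂ V) → ℂ),
      ρ'.character = ρ.character ∧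
      ∀ a : MonoidAlgebra ℂ G, ρ'.asAlgebraHom a = 0 → ρ.asAlgebraHom a = 0 := by
  let e : V ≃ₗ[ℂ] (Fin (Module.finrank ℂ V) → ℂ) := (Module.finBasis ℂ V).equivFun
  let c : Module.End ℂ V ≃ₐ[ℂ] Module.End ℂ (Fin (Module.finrank ℂ V) → ℂ) := e.conjAlgEquiv ℂ
  let ρ' : Representation ℂ G (Fin (Module.finrank ℂ V) → ℂ) :=
    (c : Module.End ℂ V →* Module.End ℂ (Fin (Module.finrank ℂ V) → ℂ)).comp ρ
  refine ⟨ρ', ?_, ?_⟩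
  · ext g
    exact LinearMap.trace_conj' (ρ g) e
  · intro a ha
    have : ρ'.asAlgebraHom = (c : _ →ₐ[ℂ] _).comp ρ.asAlgebraHom := by
      ext g
      simp [ρ']
    rw [this] at ha
    exact c.injective (by simpa using ha)

theorem exists_irr_of_isIrreducible [Finite G] (ρ : Representation ℂ G V) [ρ.IsIrreducible] :
    ∃ χ : Irr G, (χ : G → ℂ) = ρ.character := by
  have := Fintype.ofFinite G
  obtain ⟨ρ', h, -⟩ := exists_conj_fin ρ
  refine ⟨⟨ρ'.character, _, ρ', ?_, rfl⟩, h⟩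
  apply isIrreducible_of_sum_character
  rw [h]
  exact sum_character_mul_inv ρ

theorem asAlgebraHom_ofModule'_apply (M : Type*) [AddCommGroup M] [Module ℂ M]
    [Module (MonoidAlgebra ℂ G) M] [IsScalarTower ℂ (MonoidAlgebra ℂ G) M]
    (a : MonoidAlgebra ℂ G) (m : M) :
    (Representation.ofModule' (k := ℂ) (G := G) M).asAlgebraHom a m = a • m := by
  have : (Representation.ofModule' (k := ℂ) (G := G) M).asAlgebraHom =
      Algebra.lsmul ℂ ℂ M := by
    rw [Representation.asAlgebraHom_def, Representation.ofModule', Equiv.apply_symm_apply]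
  rw [this]
  rfl

theorem isIrreducible_ofModule' (M : Type*) [AddCommGroup M] [Module ℂ M]
    [Module (MonoidAlgebra ℂ G) M] [IsScalarTower ℂ (MonoidAlgebra ℂ G) M]
    [IsSimpleModule (MonoidAlgebra ℂ G) M] :
    (Representation.ofModule' (k := ℂ) (G := G) M).IsIrreducible := by
  rw [Representation.irreducible_iff_isSimpleModule_asModule]
  let ρ := Representation.ofModule' (k := ℂ) (G := G) M
  let e : ρ.asModule ≃ₗ[MonoidAlgebra ℂ G] M :=
    { ρ.asModuleEquiv.toAddEquiv with
      map_smul' := fun r x => by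
        have := ρ.asModuleEquiv_map_smul r x
        rw [asAlgebraHom_ofModule'_apply] at this
        exact this }
  exact IsSimpleModule.congr e

/-- An element killing every simple module lies in the Jacobson radical, which is zero by Maschke's
theorem. -/
theorem eq_zero_of_asAlgebraHom_eq_zero [Finite G] (a : MonoidAlgebra ℂ G)
    (ha : ∀ (n : ℕ) (ρ : Representation ℂ G (Fin n → ℂ)), ρ.IsIrreducible →
      ρ.asAlgebraHom a = 0) : a = 0 := by
  have := Fintype.ofFinite G
  have h1 : Module.jacobson (MonoidAlgebra ℂ G) (MonoidAlgebra ℂ G) = ⊥ :=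
    IsSemisimpleModule.jacobson_eq_bot _ _
  suffices h : a ∈ Module.jacobson (MonoidAlgebra ℂ G) (MonoidAlgebra ℂ G) by
    rw [h1] at h
    exact h
  rw [Module.jacobson, Submodule.mem_sInf]
  intro I hI
  have hs : IsSimpleModule (MonoidAlgebra ℂ G) (MonoidAlgebra ℂ G ⧸ I) :=
    isSimpleModule_iff_isCoatom.mpr hI
  have : FiniteDimensional ℂ (MonoidAlgebra ℂ G ⧸ I) :=
    Module.Finite.trans (MonoidAlgebra ℂ G) _
  have := isIrreducible_ofModule' (G := G) (MonoidAlgebra ℂ G ⧸ I)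
  obtain ⟨ρ', h, h'⟩ := exists_conj_fin
    (Representation.ofModule' (k := ℂ) (G := G) (MonoidAlgebra ℂ G ⧸ I))
  have hρ' : ρ'.IsIrreducible := by
    apply isIrreducible_of_sum_character
    rw [h]
    exact sum_character_mul_inv _
  have h2 := LinearMap.congr_fun (h' a (ha _ ρ' hρ')) (Submodule.Quotient.mk 1)
  rw [asAlgebraHom_ofModule'_apply, LinearMap.zero_apply, ← Submodule.Quotient.mk_smul,
    Submodule.Quotient.mk_eq_zero] at h2
  simpa using h2

end Representations

/-! ### Algebraic integers modulo `M`. -/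

section Residue

/-- An ideal of the ring of algebraic integers as a subset of `ℂ`. -/
noncomputable def coeIdeal (M : Ideal AlgInt) : Submodule AlgInt ℂ :=
  Submodule.map (Algebra.linearMap AlgInt ℂ) M

variable {M : Ideal AlgInt}

theorem mem_coeIdeal {x : ℂ} : x ∈ coeIdeal M ↔ ∃ m ∈ M, (m : ℂ) = x := Iff.rfl

theorem coe_mem_coeIdeal {m : AlgInt} : (m : ℂ) ∈ coeIdeal M ↔ m ∈ M := by
  constructor
  · rintro ⟨m', hm', h⟩
    rwa [← Subtype.ext h]
  · exact fun h => ⟨m, h, rfl⟩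

theorem mul_mem_coeIdeal {x y : ℂ} (hx : IsIntegral ℤ x) (hy : y ∈ coeIdeal M) :
    x * y ∈ coeIdeal M :=
  (coeIdeal M).smul_mem (⟨x, hx⟩ : AlgInt) hy

theorem mem_or_mem_of_mul_mem_coeIdeal [hM : M.IsPrime] {x y : ℂ} (hx : IsIntegral ℤ x)
    (hy : IsIntegral ℤ y) (h : x * y ∈ coeIdeal M) : x ∈ coeIdeal M ∨ y ∈ coeIdeal M := by
  have h' : (((⟨x, hx⟩ : AlgInt) * ⟨y, hy⟩ : AlgInt) : ℂ) ∈ coeIdeal M := h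
  rw [coe_mem_coeIdeal] at h'
  exact (hM.mem_or_mem h').imp coe_mem_coeIdeal.mpr coe_mem_coeIdeal.mpr

theorem mem_of_pow_mem_coeIdeal [hM : M.IsPrime] {x : ℂ} {n : ℕ} (hx : IsIntegral ℤ x)
    (h : x ^ n ∈ coeIdeal M) : x ∈ coeIdeal M := by
  have h' : (((⟨x, hx⟩ : AlgInt) ^ n : AlgInt) : ℂ) ∈ coeIdeal M := h
  rw [coe_mem_coeIdeal] at h'
  exact coe_mem_coeIdeal.mpr (hM.mem_of_pow_mem n h')

/-- The Frobenius map modulo `M` is injective. -/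
theorem sub_mem_coeIdeal_of_pow_sub_pow_mem [hM : M.IsPrime] {p k : ℕ} [hp : Fact p.Prime]
    (hpM : (p : AlgInt) ∈ M) {x y : ℂ} (hx : IsIntegral ℤ x) (hy : IsIntegral ℤ y)
    (h : x ^ p ^ k - y ^ p ^ k ∈ coeIdeal M) : x - y ∈ coeIdeal M := by
  have hch : CharP (AlgInt ⧸ M) p := by
    apply (CharP.charP_iff_prime_eq_zero hp.out).mpr
    rw [← map_natCast (Ideal.Quotient.mk M)]
    exact Ideal.Quotient.eq_zero_iff_mem.mpr hpM
  have h' : (((⟨x, hx⟩ : AlgInt) ^ p ^ k - ⟨y, hy⟩ ^ p ^ k : AlgInt) : ℂ) ∈ coeIdeal M := h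
  rw [coe_mem_coeIdeal, ← Ideal.Quotient.eq_zero_iff_mem, map_sub, map_pow, map_pow,
    ← sub_pow_char_pow, ← map_sub] at h'
  have h2 := Ideal.Quotient.eq_zero_iff_mem.mp (pow_eq_zero_iff (pow_ne_zero k hp.out.ne_zero) |>.mp h')
  exact coe_mem_coeIdeal.mpr h2

end Residue

/-! ### The integral group ring and elements acting by scalars. -/

section GroupRing

/-- The element of the group ring with given coefficients. -/
noncomputable def ofFun {X R : Type*} [Semiring R] [Fintype X] (a : X → R) : MonoidAlgebra R X :=
  MonoidAlgebra.ofCoeff (Finsupp.equivFunOnFinite.symm a)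

@[simp] theorem coeff_ofFun {X R : Type*} [Semiring R] [Fintype X] (a : X → R) (g : X) :
    (ofFun a).coeff g = a g := rfl

variable {G : Type*} [Group G] {V : Type*} [AddCommGroup V] [Module ℂ V]

/-- The action of the integral group ring on a representation. -/
noncomputable def intAction (ρ : Representation ℂ G V) :
    MonoidAlgebra AlgInt G →ₐ[AlgInt] Module.End ℂ V :=
  MonoidAlgebra.lift AlgInt (Module.End ℂ V) G ρ

theorem intAction_apply [Fintype G] (ρ : Representation ℂ G V) (z : MonoidAlgebra AlgInt G) :
    intAction ρ z = ∑ g, (z.coeff g : ℂ) • ρ g := by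
  rw [intAction, MonoidAlgebra.lift_apply, Finsupp.sum_fintype]
  · rfl
  · intro g
    simp

theorem coeff_mul_sum_left {R : Type*} [Semiring R] [Fintype G] (x y : MonoidAlgebra R G) (g : G) :
    (x * y).coeff g = ∑ h, x.coeff h * y.coeff (h⁻¹ * g) := by
  rw [MonoidAlgebra.coeff_mul_apply_left, Finsupp.sum_fintype]
  simp

theorem mem_center_iff_coeff_conj {R : Type*} [CommRing R] (z : MonoidAlgebra R G) :
    z ∈ Subalgebra.center R (MonoidAlgebra R G) ↔
      ∀ x g, z.coeff (x * g * x⁻¹) = z.coeff g := by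
  rw [Subalgebra.mem_center_iff]
  constructor
  · intro h x g
    have := congrArg (fun t => t.coeff (x * g)) (h (MonoidAlgebra.single x 1))
    simpa [MonoidAlgebra.coeff_single_mul_apply, MonoidAlgebra.coeff_mul_single_apply]
      using this.symm
  · intro h b
    induction b using MonoidAlgebra.induction_linear with
    | zero => simp
    | add f g hf hg => rw [add_mul, mul_add, hf, hg]
    | single x r =>
      ext g
      rw [MonoidAlgebra.coeff_single_mul_apply, MonoidAlgebra.coeff_mul_single_apply, mul_comm,
        ← h x (x⁻¹ * g)]
      simp

variable {M : Ideal AlgInt}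

theorem isIntegral_of_intAction_eq [Finite G] [Nontrivial V] (ρ : Representation ℂ G V)
    (z : MonoidAlgebra AlgInt G) (s : ℂ) (h : intAction ρ z = s • 1) : IsIntegral ℤ s := by
  have h1 : IsIntegral AlgInt z := IsIntegral.of_finite AlgInt z
  have h2 := h1.map (intAction ρ)
  rw [h, ← Algebra.algebraMap_eq_smul_one] at h2
  have h3 : IsIntegral AlgInt s :=
    (isIntegral_algHom_iff (IsScalarTower.toAlgHom AlgInt ℂ (Module.End ℂ V))
      (FaithfulSMul.algebraMap_injective ℂ (Module.End ℂ V))).mp h2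
  exact isIntegral_trans s h3

/-- Multiplication by `z` maps the group ring into `M` times itself. By the determinant trick `z`,
and hence `s`, is a root of a monic polynomial with lower coefficients in `M`, so a power of `s`
lies in `M`. Centrality of `z` plays no role, which allows elements that are only `N`-invariant. -/
theorem mem_coeIdeal_of_intAction_eq [Finite G] [Nontrivial V] [hM : M.IsPrime]
    (ρ : Representation ℂ G V) (z : MonoidAlgebra AlgInt G) (hz : ∀ g, z.coeff g ∈ M) (s : ℂ)
    (h : intAction ρ z = s • 1) : s ∈ coeIdeal M := by
  have := Fintype.ofFinite G
  let f : Module.End AlgInt (MonoidAlgebra AlgInt G) := LinearMap.mulLeft AlgInt z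
  have hf : LinearMap.range f ≤ M • (⊤ : Submodule AlgInt (MonoidAlgebra AlgInt G)) := by
    rintro _ ⟨y, rfl⟩
    have : z * y = ∑ g, z.coeff g • (MonoidAlgebra.single g 1 * y) := by
      conv_lhs => rw [← MonoidAlgebra.sum_coeff_single z, Finsupp.sum_fintype _ _ (by simp),
        Finset.sum_mul]
      refine Finset.sum_congr rfl fun g _ => ?_
      rw [← smul_mul_assoc]
      simp
    change z * y ∈ _
    rw [this]
    exact Submodule.sum_mem _ fun g _ => Submodule.smul_mem_smul (hz g) trivial
  obtain ⟨P, hP, -, hc, h0⟩ :=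
    LinearMap.exists_monic_and_natDegree_eq_and_coeff_mem_pow_and_aeval_eq_zero AlgInt f M hf
  have hs : IsIntegral ℤ s := isIntegral_of_intAction_eq ρ z s h
  have h1 : Polynomial.aeval z P = 0 := by
    have : Polynomial.aeval (Algebra.lmul AlgInt (MonoidAlgebra AlgInt G) z) P = 0 := h0
    rw [Polynomial.aeval_algHom_apply] at this
    simpa using LinearMap.congr_fun this 1
  have h2 : Polynomial.aeval s P = 0 := by
    apply FaithfulSMul.algebraMap_injective ℂ (Module.End ℂ V)
    have h3 := congrArg (intAction ρ) h1
    rw [← Polynomial.aeval_algHom_apply, h, ← Algebra.algebraMap_eq_smul_one, map_zero] at h3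
    rw [map_zero, ← h3]
    exact (Polynomial.aeval_algebraMap_apply (Module.End ℂ V) s P).symm
  have h3 : Polynomial.eval (⟨s, hs⟩ : AlgInt) P = 0 := by
    apply Subtype.ext
    rw [← Polynomial.coe_aeval_eq_eval]
    have := Polynomial.aeval_algebraMap_apply ℂ (⟨s, hs⟩ : AlgInt) P
    exact this.symm.trans h2
  rw [Polynomial.eval_eq_sum_range, Finset.sum_range_succ, hP.coeff_natDegree, one_mul] at h3
  have h4 : (⟨s, hs⟩ : AlgInt) ^ P.natDegree ∈ M := by
    rw [← neg_eq_of_add_eq_zero_right h3]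
    refine M.neg_mem (M.sum_mem fun i hi => M.mul_mem_right _ ?_)
    refine Ideal.pow_le_self ?_ (hc i)
    rw [Finset.mem_range] at hi
    omega
  exact coe_mem_coeIdeal.mpr (hM.mem_of_pow_mem _ h4)

end GroupRing

/-! ### Supports of `p`-power powers of central elements in characteristic `p`. -/

section PowerSupport

/-- On the fibre of `w` over a nonzero value, `f` acts with `p`-power order and without fixed
points, so the size of the fibre is divisible by `p`. -/
theorem sum_eq_zero_of_iterate_eq_id {α R : Type*} [Fintype α] [CommRing R] {p n : ℕ}
    [Fact p.Prime] [CharP R p] (f : α → α) (hf : f^[p ^ n] = id) (w : α → R)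
    (hw : ∀ x, w (f x) = w x) (h0 : ∀ x, f x = x → w x = 0) : ∑ x, w x = 0 := by
  rw [← Finset.sum_fiberwise_of_maps_to (t := Finset.univ.image w)
    (fun x _ => Finset.mem_image_of_mem w (Finset.mem_univ x))]
  refine Finset.sum_eq_zero fun a _ => ?_
  by_cases ha : a = 0
  · exact Finset.sum_eq_zero fun x hx => by rw [(Finset.mem_filter.mp hx).2, ha]
  rw [Finset.sum_congr rfl fun x hx => (Finset.mem_filter.mp hx).2, Finset.sum_const,
    nsmul_eq_mul]
  let g : Function.End {x // w x = a} := fun x => ⟨f x.1, by rw [hw, x.2]⟩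
  have hgi : ∀ (m : ℕ) (x : {x // w x = a}), ((g ^ m) x).1 = f^[m] x.1 := by
    intro m
    induction m with
    | zero => intro x; rfl
    | succ m ih =>
      intro x
      rw [pow_succ, Function.iterate_succ_apply]
      exact ih (g x)
  have hg : g ^ p ^ n = 1 := by
    funext x
    apply Subtype.ext
    rw [hgi, hf]
    rfl
  have hfix : IsEmpty (Function.fixedPoints g) := by
    refine ⟨fun x => ha ?_⟩
    rw [← x.1.2]
    exact h0 _ (congrArg Subtype.val x.2)
  have hc := Equiv.Perm.card_fixedPoints_modEq hg
  rw [Fintype.card_eq_zero (α := Function.fixedPoints g), Nat.modEq_zero_iff_dvd,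
    Fintype.card_subtype] at hc
  rw [(CharP.cast_eq_zero_iff R p _).mpr hc, zero_mul]

variable {G : Type*} [Group G]

theorem coeff_pow_eq_sum {R : Type*} [CommRing R] [Fintype G] (b : MonoidAlgebra R G) (n : ℕ) :
    ∀ u : G, (b ^ n).coeff u =
      ∑ f : Fin n → G, if (List.ofFn f).prod = u then ∏ i, b.coeff (f i) else 0 := by
  induction n with
  | zero =>
    intro u
    simp [MonoidAlgebra.one_def, Finsupp.single_apply]
  | succ n ih =>
    intro u
    rw [pow_succ', coeff_mul_sum_left, ← (Fin.consEquiv fun _ => G).sum_comp,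
      Fintype.sum_prod_type]
    refine Finset.sum_congr rfl fun x _ => ?_
    rw [ih, Finset.mul_sum]
    refine Finset.sum_congr rfl fun f _ => ?_
    have hc : (Fin.consEquiv fun _ : Fin (n + 1) => G) (x, f) = Fin.cons x f := rfl
    simp only [hc, List.ofFn_cons, List.prod_cons, Fin.prod_univ_succ,
      Fin.cons_zero, Fin.cons_succ, eq_inv_mul_iff_mul_eq, mul_ite, mul_zero]

/-- Rotation of a tuple, twisted by conjugation with `u`. -/
def twistedRotate (u : G) (n : ℕ) (f : Fin (n + 1) → G) : Fin (n + 1) → G :=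
  Fin.snoc (α := fun _ => G) (Fin.tail f) (u⁻¹ * f 0 * u)

/-- The twisted-periodic extension of a tuple to a sequence. -/
def twistedExtend (u : G) (n : ℕ) (f : Fin (n + 1) → G) (i : ℕ) : G :=
  (u ^ (i / (n + 1)))⁻¹ * f ⟨i % (n + 1), Nat.mod_lt _ n.succ_pos⟩ * u ^ (i / (n + 1))

/-- On extended sequences the rotation becomes the shift by one, which makes its iterates
computable. -/
theorem twistedExtend_twistedRotate (u : G) (n : ℕ) (f : Fin (n + 1) → G) (i : ℕ) :
    twistedExtend u n (twistedRotate u n f) i = twistedExtend u n f (i + 1) := by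
  have hi : i % (n + 1) < n + 1 := Nat.mod_lt _ n.succ_pos
  unfold twistedExtend twistedRotate
  rcases Nat.lt_or_ge (i % (n + 1)) n with h | h
  · have h1 : (i + 1) / (n + 1) = i / (n + 1) := by
      rw [Nat.succ_div, if_neg]
      · rfl
      · intro hd
        have := Nat.mod_eq_zero_of_dvd hd
        rw [Nat.add_mod, Nat.mod_eq_of_lt (a := 1) (by omega), Nat.mod_eq_of_lt (by omega)] at this
        omega
    have h2 : (i + 1) % (n + 1) = i % (n + 1) + 1 := by
      rw [Nat.add_mod, Nat.mod_eq_of_lt (a := 1) (by omega), Nat.mod_eq_of_lt (by omega)]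
    have h3 : (⟨i % (n + 1), hi⟩ : Fin (n + 1)) = Fin.castSucc ⟨i % (n + 1), h⟩ := rfl
    rw [h3, Fin.snoc_castSucc, h1]
    simp only [Fin.tail, h2]
    rfl
  · have h0 : i % (n + 1) = n := by omega
    have hd : n + 1 ∣ i + 1 := by
      refine ⟨i / (n + 1) + 1, ?_⟩
      have := Nat.div_add_mod i (n + 1)
      rw [h0] at this
      rw [mul_add]
      omega
    have h1 : (i + 1) / (n + 1) = i / (n + 1) + 1 := by
      rw [Nat.succ_div, if_pos hd]
    have h2 : (i + 1) % (n + 1) = 0 := Nat.mod_eq_zero_of_dvd hd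
    have h3 : (⟨i % (n + 1), hi⟩ : Fin (n + 1)) = Fin.last n := Fin.ext h0
    have h4 : (⟨(i + 1) % (n + 1), Nat.mod_lt _ n.succ_pos⟩ : Fin (n + 1)) = 0 := Fin.ext h2
    rw [h3, Fin.snoc_last, h4, h1, pow_succ']
    group

theorem iterate_twistedRotate (u : G) (n m : ℕ) (hu : u ^ m = 1) :
    (twistedRotate u n)^[(n + 1) * m] = id := by
  have key : ∀ (j : ℕ) (f : Fin (n + 1) → G) (i : ℕ),
      twistedExtend u n ((twistedRotate u n)^[j] f) i = twistedExtend u n f (i + j) := by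
    intro j
    induction j with
    | zero => intro f i; rfl
    | succ j ih =>
      intro f i
      rw [Function.iterate_succ_apply, ih, twistedExtend_twistedRotate, add_assoc]
  have hlt : ∀ (f : Fin (n + 1) → G) (i : Fin (n + 1)), twistedExtend u n f i = f i := by
    intro f i
    simp [twistedExtend, Nat.div_eq_of_lt i.2, Nat.mod_eq_of_lt i.2]
  funext f
  funext i
  have h1 : (i + (n + 1) * m) / (n + 1) = m := by
    rw [Nat.add_mul_div_left _ _ n.succ_pos, Nat.div_eq_of_lt i.2, zero_add]
  have h2 : (⟨(i + (n + 1) * m) % (n + 1), Nat.mod_lt _ n.succ_pos⟩ : Fin (n + 1)) = i :=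
    Fin.ext ((Nat.add_mul_mod_self_left _ _ _).trans (Nat.mod_eq_of_lt i.2))
  rw [← hlt ((twistedRotate u n)^[(n + 1) * m] f) i, key, twistedExtend, h1, h2, hu]
  simp

/-- `E` is a power of `p`, and `x ^ E` is the `p`-regular part of every `x` in `G`
up to a permutation of the `p`-regular elements. -/
structure IsRegularExponent (p E : ℕ) (G : Type*) [Group G] : Prop where
  exists_eq_pow : ∃ k, 0 < k ∧ E = p ^ k
  pow_pow : ∀ x : G, (x ^ E) ^ E = x ^ E

/-- The `E`-th power of a central element of the group ring in characteristic `p` is supported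
on the `p`-regular elements. -/
theorem coeff_pow_eq_zero {k : Type*} [CommRing k] {p E : ℕ} [Fact p.Prime] [CharP k p]
    [Fintype G] (hE : IsRegularExponent p E G) (z : MonoidAlgebra k G)
    (hz : z ∈ Subalgebra.center k (MonoidAlgebra k G)) (g : G) (hg : g ^ E ≠ g) :
    (z ^ E).coeff g = 0 := by
  obtain ⟨j, hj, hEj⟩ := hE.exists_eq_pow
  -- `s` is the `p`-regular part of `g` and `u` the `p`-part. Since `s ^ E = s`, multiplying `z` by
  -- `s⁻¹` moves the coefficient of the `E`-th power from `g` to `u`.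
  set s := g ^ E with hs
  set u := g * s⁻¹ with hu
  have hss : s ^ E = s := hE.pow_pow g
  have hgs : Commute g s := Commute.pow_right (Commute.refl g) E
  have huE : u ^ E = 1 := by
    rw [hu, hgs.inv_right.mul_pow, inv_pow, hss, hs, mul_inv_cancel]
  have hu1 : u ≠ 1 := by
    intro h
    exact hg (mul_inv_eq_one.mp h).symm
  have hus : Commute u s := hgs.mul_left (Commute.refl s).inv_left
  let b : MonoidAlgebra k G := z * MonoidAlgebra.single s⁻¹ 1
  have hzc : ∀ y, Commute z y := fun y => ((Subalgebra.mem_center_iff.mp hz) y).symm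
  have hb : b ^ E = z ^ E * MonoidAlgebra.single s⁻¹ 1 := by
    rw [(hzc _).mul_pow, MonoidAlgebra.single_pow, inv_pow, hss, one_pow]
  have h1 : (z ^ E).coeff g = (b ^ E).coeff u := by
    rw [hb, MonoidAlgebra.coeff_mul_single_apply, inv_inv, mul_one, hu, inv_mul_cancel_right]
  have hbc : ∀ x, b.coeff (u⁻¹ * x * u) = b.coeff x := by
    intro x
    rw [MonoidAlgebra.coeff_mul_single_apply, MonoidAlgebra.coeff_mul_single_apply, inv_inv,
      mul_one, mul_one, ← (mem_center_iff_coeff_conj z).mp hz u⁻¹ (x * s)]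
    congr 1
    rw [inv_inv, mul_assoc, hus.eq]
    group
  rw [h1, coeff_pow_eq_sum]
  obtain ⟨n, hn⟩ : ∃ n, E = n + 1 := ⟨E - 1, by
    have : 0 < E := by rw [hEj]; exact pow_pos (Fact.out : p.Prime).pos j
    omega⟩
  clear_value s u b
  subst hn
  have hprod : ∀ f : Fin (n + 1) → G,
      (List.ofFn (twistedRotate u n f)).prod = f⁻¹ 0 * (List.ofFn f).prod * (u⁻¹ * f 0 * u) := by
    intro f
    rw [twistedRotate, List.ofFn_succ', List.prod_concat, List.ofFn_succ (f := f), List.prod_cons]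
    simp only [Pi.inv_apply, inv_mul_cancel_left, Fin.snoc_castSucc, Fin.snoc_last]
    rfl
  -- The coefficient at `u` is a sum over `E`-tuples with product `u`. Twisted rotation preserves
  -- this condition, and its `E * E`-th iterate is the identity because `u ^ E = 1`.
  refine sum_eq_zero_of_iterate_eq_id (p := p) (n := j + j) (twistedRotate u n) ?_ _ ?_ ?_
  · rw [pow_add, ← hEj]
    exact iterate_twistedRotate u n (n + 1) huE
  · intro f
    rw [hprod]
    have h2 : f⁻¹ 0 * (List.ofFn f).prod * (u⁻¹ * f 0 * u) = u ↔ (List.ofFn f).prod = u := by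
      simp only [Pi.inv_apply]
      constructor
      · intro h
        rw [mul_assoc, inv_mul_eq_iff_eq_mul, ← eq_mul_inv_iff_mul_eq] at h
        rw [h]
        group
      · intro h
        rw [h]
        group
    have h3 : ∏ i, b.coeff (twistedRotate u n f i) = ∏ i, b.coeff (f i) := by
      rw [Fin.prod_univ_castSucc, Fin.prod_univ_succ, mul_comm]
      simp only [twistedRotate, Fin.snoc_last, Fin.snoc_castSucc, hbc, Fin.tail]
    simp only [h2, h3]
  -- A fixed tuple is constant, so product `u` would mean `f 0 ^ E = u`, whence `u = u ^ E = 1`.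
  · intro f hf
    rw [if_neg]
    intro hfu
    have hconst : ∀ i : Fin (n + 1), f i = f 0 := by
      intro i
      induction i using Fin.induction with
      | zero => rfl
      | succ i ih =>
        rw [← ih]
        conv_rhs => rw [← hf]
        simp [twistedRotate, Fin.tail]
    have hf' : f = fun _ => f 0 := funext hconst
    rw [hf', List.ofFn_const, List.prod_replicate] at hfu
    rw [← hfu, hE.pow_pow] at huE
    exact hu1 (hfu.symm.trans huE)

theorem exists_isRegularExponent (p : ℕ) [hp : Fact p.Prime] (G : Type*) [Group G] [Finite G] :
    ∃ E, IsRegularExponent p E G := by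
  obtain ⟨a, m, hm, hc⟩ :=
    Nat.exists_eq_pow_mul_and_not_dvd (Nat.card_pos (α := G)).ne' p hp.out.ne_one
  have hcop : Nat.Coprime p m := (Nat.Prime.coprime_iff_not_dvd hp.out).mpr hm
  have hm0 : 0 < m := Nat.pos_of_ne_zero fun h => hm (h ▸ dvd_zero p)
  have hφ : 0 < m.totient := Nat.totient_pos.mpr hm0
  -- The factor `m.totient` gives `p ^ k ≡ 1` modulo `m`, and the factor `a + 1` gives `a ≤ k`.
  -- Together the order of `G` divides `E * (E - 1)` for `E = p ^ k`.
  set k := m.totient * (a + 1) with hk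
  have hk0 : 0 < k := by positivity
  have hak : a ≤ k := by nlinarith
  refine ⟨p ^ k, ⟨k, hk0, rfl⟩, fun x => ?_⟩
  have h1 : p ^ k ≡ 1 [MOD m] := by
    have := (Nat.ModEq.pow_totient hcop).pow (a + 1)
    rwa [← pow_mul, one_pow] at this
  have h2 : m ∣ p ^ k - 1 :=
    (Nat.modEq_iff_dvd' (Nat.one_le_pow _ _ hp.out.pos)).mp h1.symm
  have h3 : Nat.card G ∣ p ^ k * (p ^ k - 1) := by
    rw [hc]
    exact mul_dvd_mul (pow_dvd_pow p hak) h2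
  have h4 : p ^ k * p ^ k = p ^ k * (p ^ k - 1) + p ^ k := by
    have := Nat.one_le_pow k p hp.out.pos
    rw [← Nat.mul_succ, Nat.succ_eq_add_one, Nat.sub_add_cancel this]
  rw [← pow_mul, h4, pow_add, pow_eq_one_iff_modEq.mpr, one_mul]
  exact (Nat.modEq_zero_iff_dvd.mpr ((orderOf_dvd_natCard x).trans h3))

end PowerSupport

/-! ### Character values, central characters and blocks. -/

section Characters

variable {G : Type*} [Group G]

/-- A character value is a sum of eigenvalues, which are roots of unity. -/
theorem isIntegral_character [Finite G] {V : Type*} [AddCommGroup V] [Module ℂ V]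
    [FiniteDimensional ℂ V] (ρ : Representation ℂ G V) (g : G) :
    IsIntegral ℤ (ρ.character g) := by
  have h : ρ.character g = (ρ g).charpoly.roots.sum := by
    rw [Representation.character, ← Module.End.trace_eq_sum_roots_charpoly_of_splits (IsAlgClosed.splits _)]
  rw [h]
  refine IsIntegral.multiset_sum fun μ hμ => ?_
  have hμ' : Module.End.HasEigenvalue (ρ g) μ := by
    rw [Module.End.hasEigenvalue_iff_isRoot_charpoly]
    exact Polynomial.isRoot_of_mem_roots hμ
  have h1 : μ ^ Nat.card G = 1 := by
    obtain ⟨v, hv⟩ := hμ'.exists_hasEigenvector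
    have h2 := hv.pow_apply (Nat.card G)
    rw [← map_pow, pow_card_eq_one', map_one, Module.End.one_apply] at h2
    have h3 : (μ ^ Nat.card G - 1) • v = 0 := by rw [sub_smul, ← h2, one_smul, sub_self]
    exact sub_eq_zero.mp ((smul_eq_zero.mp h3).resolve_right hv.2)
  exact IsIntegral.of_pow Nat.card_pos (h1 ▸ isIntegral_one)

theorem nontrivial_of_isIrreducible {V : Type*} [AddCommGroup V] [Module ℂ V]
    (ρ : Representation ℂ G V) [hρ : ρ.IsIrreducible] : Nontrivial V := by
  by_contra h
  rw [not_nontrivial_iff_subsingleton] at h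
  obtain ⟨a, b, hab⟩ := hρ.toNontrivial
  apply hab
  ext v
  rw [Subsingleton.elim v 0]
  simp

namespace Irr

theorem exists_one_eq (χ : Irr G) : ∃ d : ℕ, 0 < d ∧ χ 1 = d := by
  obtain ⟨χ, n, ρ, hρ, rfl⟩ := χ
  have := nontrivial_of_isIrreducible ρ
  exact ⟨_, Module.finrank_pos (R := ℂ) (M := Fin n → ℂ), Representation.char_one ρ⟩

theorem one_ne_zero (χ : Irr G) : χ 1 ≠ 0 := by
  obtain ⟨d, hd, h⟩ := exists_one_eq χ
  rw [h]
  exact_mod_cast hd.ne'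

theorem mul_comm (χ : Irr G) (g h : G) : χ (g * h) = χ (h * g) := by
  obtain ⟨χ, n, ρ, hρ, rfl⟩ := χ
  exact Representation.char_mul_comm ρ h g

theorem conj (χ : Irr G) (g x : G) : χ (x * g * x⁻¹) = χ g := by
  rw [mul_comm, inv_mul_cancel_left]

theorem isIntegral [Finite G] (χ : Irr G) (g : G) : IsIntegral ℤ (χ g) := by
  obtain ⟨χ, n, ρ, hρ, rfl⟩ := χ
  exact isIntegral_character ρ g

theorem sum_mul_inv [Fintype G] (χ : Irr G) : ∑ g, χ g * χ g⁻¹ = Nat.card G := by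
  obtain ⟨χ, n, ρ, hρ, rfl⟩ := χ
  exact sum_character_mul_inv ρ

end Irr

/-- The central character of `χ`, extended linearly to the integral group ring. -/
noncomputable def omega [Fintype G] (χ : G → ℂ) (z : MonoidAlgebra AlgInt G) : ℂ :=
  (∑ g, (z.coeff g : ℂ) * χ g) / χ 1

theorem intAction_eq_omega_smul [Fintype G] {V : Type*} [AddCommGroup V] [Module ℂ V]
    [FiniteDimensional ℂ V] (ρ : Representation ℂ G V) (s : ℂ) [Nontrivial V]
    (z : MonoidAlgebra AlgInt G) (h : intAction ρ z = s • 1) : omega ρ.character z = s := by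
  have hd : (Module.finrank ℂ V : ℂ) ≠ 0 := by
    exact_mod_cast (Module.finrank_pos (R := ℂ) (M := V)).ne'
  have h1 := congrArg (LinearMap.trace ℂ V) h
  rw [intAction_apply, map_sum, map_smul, LinearMap.trace_one] at h1
  rw [omega, Representation.char_one, div_eq_iff hd, ← smul_eq_mul s, ← h1]
  exact Finset.sum_congr rfl fun g _ => by rw [map_smul]; rfl

theorem intAction_of_mem_center [Fintype G] {V : Type*} [AddCommGroup V] [Module ℂ V]
    [FiniteDimensional ℂ V] (ρ : Representation ℂ G V) [ρ.IsIrreducible]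
    {z : MonoidAlgebra AlgInt G} (hz : z ∈ Subalgebra.center AlgInt (MonoidAlgebra AlgInt G)) :
    intAction ρ z = omega ρ.character z • 1 := by
  have := nontrivial_of_isIrreducible ρ
  have h := eq_smul_one_of_commute ρ (intAction ρ z) fun g => by
    have h1 := congrArg (intAction ρ)
      (Subalgebra.mem_center_iff.mp hz (MonoidAlgebra.single g 1))
    rw [map_mul, map_mul] at h1
    have h2 : intAction ρ (MonoidAlgebra.single g 1) = ρ g := by simp [intAction]
    rw [h2] at h1
    exact h1.symm
  rw [intAction_eq_omega_smul ρ _ z h]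
  exact h

theorem bl_eq_iff {M : Ideal AlgInt} {χ ψ : Irr G} :
    bl M χ = bl M ψ ↔ ∀ g, centralChar χ g - centralChar ψ g ∈ coeIdeal M :=
  Quotient.eq

section Omega

variable [Fintype G] (χ ψ : Irr G) {z w : MonoidAlgebra AlgInt G} {M : Ideal AlgInt}

theorem omega_mul (hz : z ∈ Subalgebra.center AlgInt (MonoidAlgebra AlgInt G))
    (hw : w ∈ Subalgebra.center AlgInt (MonoidAlgebra AlgInt G)) :
    omega χ (z * w) = omega χ z * omega χ w := by
  obtain ⟨χ, n, ρ, hρ, rfl⟩ := χ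
  have := nontrivial_of_isIrreducible ρ
  apply intAction_eq_omega_smul ρ
  rw [map_mul, intAction_of_mem_center ρ hz, intAction_of_mem_center ρ hw]
  simp [smul_smul, mul_comm]

theorem omega_one : omega χ 1 = 1 := by
  obtain ⟨χ, n, ρ, hρ, rfl⟩ := χ
  have := nontrivial_of_isIrreducible ρ
  apply intAction_eq_omega_smul ρ
  simp

theorem omega_pow (hz : z ∈ Subalgebra.center AlgInt (MonoidAlgebra AlgInt G)) (n : ℕ) :
    omega χ (z ^ n) = omega χ z ^ n := by
  induction n with
  | zero => simpa using omega_one χ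
  | succ n ih => rw [pow_succ, pow_succ, omega_mul χ (pow_mem hz n) hz, ih]

theorem omega_sub : omega χ (z - w) = omega χ z - omega χ w := by
  simp only [omega, MonoidAlgebra.coeff_sub, Finsupp.sub_apply, AddSubgroupClass.coe_sub, sub_mul,
    Finset.sum_sub_distrib, sub_div]

theorem omega_smul (a : AlgInt) : omega χ (a • z) = a * omega χ z := by
  simp only [omega, MonoidAlgebra.coeff_smul, Finsupp.smul_apply, smul_eq_mul, MulMemClass.coe_mul,
    mul_assoc, ← Finset.mul_sum, mul_div_assoc]

theorem isIntegral_omega (hz : z ∈ Subalgebra.center AlgInt (MonoidAlgebra AlgInt G)) :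
    IsIntegral ℤ (omega χ z) := by
  obtain ⟨χ, n, ρ, hρ, rfl⟩ := χ
  have := nontrivial_of_isIrreducible ρ
  exact isIntegral_of_intAction_eq ρ z _ (intAction_of_mem_center ρ hz)

theorem omega_mem_coeIdeal [M.IsPrime]
    (hz : z ∈ Subalgebra.center AlgInt (MonoidAlgebra AlgInt G)) (h : ∀ g, z.coeff g ∈ M) :
    omega χ z ∈ coeIdeal M := by
  obtain ⟨χ, n, ρ, hρ, rfl⟩ := χ
  have := nontrivial_of_isIrreducible ρ
  exact mem_coeIdeal_of_intAction_eq ρ z h _ (intAction_of_mem_center ρ hz)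

/-- The sum of the conjugacy class of `g`. -/
noncomputable def classSum (g : G) : MonoidAlgebra AlgInt G :=
  ofFun fun x => if IsConj g x then 1 else 0

theorem classSum_mem_center (g : G) :
    classSum g ∈ Subalgebra.center AlgInt (MonoidAlgebra AlgInt G) := by
  rw [mem_center_iff_coeff_conj]
  intro x h
  have : IsConj g (x * h * x⁻¹) ↔ IsConj g h :=
    ⟨fun H => H.trans (isConj_iff.mpr ⟨x⁻¹, by group⟩), fun H => H.trans (isConj_iff.mpr ⟨x, rfl⟩)⟩
  simp only [classSum, coeff_ofFun, this]

theorem omega_classSum (g : G) : omega χ (classSum g) = centralChar χ g := by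
  rw [omega, centralChar]
  congr 1
  have h : ∀ x, ((classSum g).coeff x : ℂ) * χ x = if x ∈ conjugatesOf g then χ g else 0 := by
    intro x
    simp only [classSum, coeff_ofFun]
    have hxm : x ∈ conjugatesOf g ↔ IsConj g x := Iff.rfl
    simp only [hxm]
    by_cases hx : IsConj g x
    · obtain ⟨c, rfl⟩ := isConj_iff.mp hx
      rw [if_pos hx, if_pos hx, Irr.conj]
      simp
    · rw [if_neg hx, if_neg hx]
      simp
  rw [Finset.sum_congr rfl fun x _ => h x, ← Finset.sum_filter, Finset.sum_const, nsmul_eq_mul,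
    Nat.card_eq_fintype_card, Fintype.card_subtype]

theorem isIntegral_centralChar (g : G) : IsIntegral ℤ (centralChar χ g) := by
  rw [← omega_classSum]
  exact isIntegral_omega χ (classSum_mem_center g)

theorem sum_eq_sum_conjClasses (F : G → ℂ) (hF : ∀ x g, F (x * g * x⁻¹) = F g) :
    ∑ g, F g = ∑ K : ConjClasses G,
      (Nat.card (conjugatesOf (Quotient.out K : G)) : ℂ) * F (Quotient.out K) := by
  rw [← Finset.sum_fiberwise Finset.univ (ConjClasses.mk : G → ConjClasses G) F]
  refine Finset.sum_congr rfl fun K _ => ?_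
  have h : ∀ x, ConjClasses.mk x = K ↔ x ∈ conjugatesOf (Quotient.out K : G) := by
    intro x
    change _ ↔ IsConj _ _
    rw [isConj_comm, ← ConjClasses.mk_eq_mk_iff_isConj]
    have : ConjClasses.mk (Quotient.out K : G) = K := Quotient.out_eq K
    rw [this]
  rw [Nat.card_eq_fintype_card, Fintype.card_subtype, ← nsmul_eq_mul, ← Finset.sum_const]
  refine Finset.sum_congr (by ext x; simp [h]) fun x hx => ?_
  obtain ⟨c, rfl⟩ := isConj_iff.mp (Finset.mem_filter.mp hx).2
  exact hF c _

/-- The hypothesis concerns products so that either factor may be the one in `M`: the difference of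
central characters, or the coefficient. -/
theorem omega_sub_mem_coeIdeal
    (hz : z ∈ Subalgebra.center AlgInt (MonoidAlgebra AlgInt G))
    (h : ∀ g, z.coeff g * (centralChar χ g - centralChar ψ g) ∈ coeIdeal M) :
    omega χ z - omega ψ z ∈ coeIdeal M := by
  have key : ∀ χ : Irr G, omega χ z = ∑ K : ConjClasses G,
      (z.coeff (Quotient.out K) : ℂ) * centralChar χ (Quotient.out K) := by
    intro χ
    rw [omega, sum_eq_sum_conjClasses, Finset.sum_div]
    · refine Finset.sum_congr rfl fun K _ => ?_
      rw [centralChar]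
      ring
    · intro x g
      rw [Irr.conj, (mem_center_iff_coeff_conj z).mp hz]
  rw [key, key, ← Finset.sum_sub_distrib]
  refine Submodule.sum_mem _ fun K _ => ?_
  rw [← mul_sub]
  exact h _

theorem omega_sub_mem_of_bl_eq {χ ψ : Irr G} (h : bl M χ = bl M ψ)
    (hz : z ∈ Subalgebra.center AlgInt (MonoidAlgebra AlgInt G)) :
    omega χ z - omega ψ z ∈ coeIdeal M :=
  omega_sub_mem_coeIdeal χ ψ hz fun g => mul_mem_coeIdeal (z.coeff g).2 (bl_eq_iff.mp h g)

variable {p E : ℕ} [hp : Fact p.Prime]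

theorem charP_quotient [hM : M.IsPrime] (hpM : (p : AlgInt) ∈ M) : CharP (AlgInt ⧸ M) p := by
  apply (CharP.charP_iff_prime_eq_zero hp.out).mpr
  rw [← map_natCast (Ideal.Quotient.mk M)]
  exact Ideal.Quotient.eq_zero_iff_mem.mpr hpM

theorem coeff_pow_mem [hM : M.IsPrime] (hpM : (p : AlgInt) ∈ M) (hE : IsRegularExponent p E G)
    (hz : z ∈ Subalgebra.center AlgInt (MonoidAlgebra AlgInt G)) (g : G) (hg : g ^ E ≠ g) :
    (z ^ E).coeff g ∈ M := by
  have := charP_quotient hpM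
  rw [← Ideal.Quotient.eq_zero_iff_mem, ← MonoidAlgebra.coeff_mapRingHom, map_pow]
  refine coeff_pow_eq_zero hE _ ?_ g hg
  rw [mem_center_iff_coeff_conj] at hz ⊢
  intro x g
  rw [MonoidAlgebra.coeff_mapRingHom, MonoidAlgebra.coeff_mapRingHom, hz]

/-- Blocks are determined by the values of central characters on `p`-regular classes. -/
theorem bl_eq_of_regular [hM : M.IsPrime] (hpM : (p : AlgInt) ∈ M)
    (hE : IsRegularExponent p E G) {χ ψ : Irr G}
    (h : ∀ g, g ^ E = g → centralChar χ g - centralChar ψ g ∈ coeIdeal M) :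
    bl M χ = bl M ψ := by
  rw [bl_eq_iff]
  intro g
  obtain ⟨k, -, hk⟩ := hE.exists_eq_pow
  have hz := classSum_mem_center g
  rw [← omega_classSum, ← omega_classSum]
  -- Frobenius is injective modulo `M`, so `E`-th powers may be compared; modulo `M` the `E`-th
  -- power of a class sum is supported on `p`-regular elements.
  refine sub_mem_coeIdeal_of_pow_sub_pow_mem (p := p) (k := k) hpM (isIntegral_omega χ hz)
    (isIntegral_omega ψ hz) ?_
  rw [← hk, ← omega_pow χ hz, ← omega_pow ψ hz]
  refine omega_sub_mem_coeIdeal χ ψ (pow_mem hz E) fun x => ?_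
  by_cases hx : x ^ E = x
  · exact mul_mem_coeIdeal (Subtype.property _) (h x hx)
  · rw [mul_comm]
    refine mul_mem_coeIdeal ((isIntegral_centralChar χ x).sub (isIntegral_centralChar ψ x)) ?_
    exact coe_mem_coeIdeal.mpr (coeff_pow_mem hpM hE hz x hx)

end Omega

end Characters

/-! ### Nilpotency modulo `M` in the centre of the integral group ring. -/

section Nilpotent

variable {X : Type*} [Group X] {M : Ideal AlgInt}

theorem asAlgebraHom_map_eq_intAction {V : Type*} [AddCommGroup V] [Module ℂ V]
    (ρ : Representation ℂ X V) (z : MonoidAlgebra AlgInt X) :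
    ρ.asAlgebraHom (MonoidAlgebra.mapRingHom X (algebraMap AlgInt ℂ) z) = intAction ρ z := by
  induction z using MonoidAlgebra.induction_linear with
  | zero => simp
  | add f g hf hg => rw [map_add, map_add, map_add, hf, hg]
  | single x r =>
    rw [MonoidAlgebra.mapRingHom_single, Representation.asAlgebraHom_single, intAction,
      MonoidAlgebra.lift_single]
    rfl

variable [Fintype X]

theorem eq_zero_of_intAction_eq_zero (z : MonoidAlgebra AlgInt X)
    (hz : ∀ (n : ℕ) (ρ : Representation ℂ X (Fin n → ℂ)), ρ.IsIrreducible →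
      intAction ρ z = 0) : z = 0 := by
  have h := eq_zero_of_asAlgebraHom_eq_zero
    (MonoidAlgebra.mapRingHom X (algebraMap AlgInt ℂ) z) fun n ρ hρ => by
      rw [asAlgebraHom_map_eq_intAction, hz n ρ hρ]
  ext x
  have := congrArg (fun t => t.coeff x) h
  simpa [MonoidAlgebra.coeff_mapRingHom] using this

/-- A central element of the integral group ring on which all central characters vanish modulo
`M` is nilpotent modulo `M`. -/
theorem exists_pow_coeff_mem (Y : MonoidAlgebra AlgInt X)
    (hY : Y ∈ Subalgebra.center AlgInt (MonoidAlgebra AlgInt X))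
    (h : ∀ η : Irr X, omega η Y ∈ coeIdeal M) : ∃ m : ℕ, ∀ x, (Y ^ m).coeff x ∈ M := by
  have := finite_irr X
  have := Fintype.ofFinite (Irr X)
  choose a haM ha using fun η => mem_coeIdeal.mp (h η)
  -- `P` annihilates `Y` because it does so in every irreducible representation; modulo `M` it is a
  -- power of `X`.
  let P : Polynomial AlgInt := ∏ η : Irr X, (Polynomial.X - Polynomial.C (a η))
  have hPm : P.Monic := Polynomial.monic_prod_of_monic _ _ fun η _ => Polynomial.monic_X_sub_C _
  have h1 : Polynomial.aeval Y P = 0 := by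
    apply eq_zero_of_intAction_eq_zero
    intro n ρ hρ
    let η : Irr X := ⟨ρ.character, n, ρ, hρ, rfl⟩
    have h2 : intAction ρ Y = algebraMap AlgInt (Module.End ℂ (Fin n → ℂ)) (a η) := by
      rw [intAction_of_mem_center ρ hY]
      change omega η Y • (1 : Module.End ℂ (Fin n → ℂ)) = _
      rw [← ha]
      rfl
    rw [← Polynomial.aeval_algHom_apply, h2, Polynomial.aeval_algebraMap_apply]
    have h3 : Polynomial.aeval (a η) P = 0 := by
      rw [Polynomial.coe_aeval_eq_eval, Polynomial.eval_prod]
      exact Finset.prod_eq_zero (Finset.mem_univ η) (by simp)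
    rw [h3, map_zero]
  have h2 : P.map (Ideal.Quotient.mk M) = Polynomial.X ^ (Fintype.card (Irr X)) := by
    rw [Polynomial.map_prod, Finset.prod_congr rfl (g := fun _ => Polynomial.X)]
    · simp
    · intro η _
      simp [Ideal.Quotient.eq_zero_iff_mem.mpr (haM η)]
  have hdeg : P.natDegree = Fintype.card (Irr X) := by
    rw [Polynomial.natDegree_prod_of_monic _ _ fun η _ => Polynomial.monic_X_sub_C _]
    simp
  refine ⟨P.natDegree, fun x => ?_⟩
  rw [Polynomial.aeval_eq_sum_range, Finset.sum_range_succ, hPm.coeff_natDegree, one_smul] at h1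
  rw [eq_neg_of_add_eq_zero_right h1, MonoidAlgebra.coeff_neg, Finsupp.neg_apply,
    MonoidAlgebra.coeff_sum, Finsupp.finsetSum_apply]
  refine M.neg_mem (M.sum_mem fun i hi => ?_)
  rw [MonoidAlgebra.coeff_smul, Finsupp.smul_apply, smul_eq_mul]
  refine M.mul_mem_right _ ?_
  rw [← Ideal.Quotient.eq_zero_iff_mem, ← Polynomial.coeff_map, h2, Polynomial.coeff_X_pow,
    if_neg]
  rw [Finset.mem_range] at hi
  omega

end Nilpotent

/-! ### Character sums over conjugates and over cosets. -/

section CosetSums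

variable {G : Type*} [Group G]

theorem sum_conj_apply {V : Type*} [AddCommGroup V] [Module ℂ V] [FiniteDimensional ℂ V]
    (ρ : Representation ℂ G V) {ι : Type*} [Fintype ι] (n : ι → G) (y : G) (x : G)
    (h : ∑ i, ρ (n i * y * (n i)⁻¹) =
      (LinearMap.trace ℂ V (∑ i, ρ (n i * y * (n i)⁻¹)) / Module.finrank ℂ V) • 1) :
    ∑ i, ρ.character (x * (n i * y * (n i)⁻¹)) =
      Fintype.card ι * ρ.character x * ρ.character y / ρ.character 1 := by
  have h1 : LinearMap.trace ℂ V (∑ i, ρ (n i * y * (n i)⁻¹)) =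
      Fintype.card ι * ρ.character y := by
    rw [map_sum]
    have : ∀ i, LinearMap.trace ℂ V (ρ (n i * y * (n i)⁻¹)) = ρ.character y :=
      fun i => Representation.char_conj ρ y (n i)
    rw [Finset.sum_congr rfl fun i _ => this i, Finset.sum_const, Finset.card_univ, nsmul_eq_mul]
  rw [h1] at h
  have h2 : ∑ i, ρ.character (x * (n i * y * (n i)⁻¹)) =
      LinearMap.trace ℂ V (ρ x * ∑ i, ρ (n i * y * (n i)⁻¹)) := by
    rw [Finset.mul_sum, map_sum]
    simp only [Representation.character, map_mul]
  rw [h2, h, mul_smul_comm, mul_one, map_smul, Representation.char_one, smul_eq_mul]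
  change _ * ρ.character x = _
  ring

variable [Fintype G]

theorem sum_filter_mk_eq {E : Type*} [AddCommMonoid E] (S : Subgroup G) (F : G → E) (g : G) :
    ∑ x with (QuotientGroup.mk x : G ⧸ S) = QuotientGroup.mk g, F x = ∑ n : S, F (g * n) := by
  symm
  refine Finset.sum_bij (fun n _ => g * (n : G)) ?_ ?_ ?_ ?_
  · intro n _
    simp
  · intro n _ m _ h
    exact Subtype.ext (mul_left_cancel h)
  · intro x hx
    have h : g⁻¹ * x ∈ S := QuotientGroup.eq.mp (Finset.mem_filter.mp hx).2.symm
    exact ⟨⟨g⁻¹ * x, h⟩, Finset.mem_univ _, by simp⟩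
  · intro n _
    rfl

theorem sum_eq_card_smul_sum_out {E : Type*} [AddCommMonoid E] (S : Subgroup G) (F : G → E)
    (hF : ∀ g, ∀ s ∈ S, F (g * s) = F g) :
    ∑ g, F g = Nat.card S • ∑ q : G ⧸ S, F q.out := by
  rw [← Finset.sum_fiberwise Finset.univ (QuotientGroup.mk : G → G ⧸ S) F, Finset.smul_sum]
  refine Finset.sum_congr rfl fun q _ => ?_
  have h := sum_filter_mk_eq S F q.out
  rw [QuotientGroup.out_eq'] at h
  have h2 : ∀ n : S, F (q.out * (n : G)) = F q.out := fun n => hF _ n n.2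
  simp only [h, h2, Finset.sum_const, Finset.card_univ, Nat.card_eq_fintype_card]

namespace Irr

theorem sum_conj_mul (χ : Irr G) (a b : G) :
    ∑ y, χ (y * a * y⁻¹ * b) = Nat.card G * χ a * χ b / χ 1 := by
  obtain ⟨χ, n, ρ, hρ, rfl⟩ := χ
  have h := sum_conj_apply ρ (fun y : G => y) a b (eq_smul_one_of_commute ρ _ fun g => by
    rw [commute_iff_eq, Finset.sum_mul, Finset.mul_sum]
    refine Fintype.sum_equiv (Equiv.mulLeft g⁻¹) _ _ fun y => ?_
    rw [← map_mul, ← map_mul]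
    congr 1
    simp [mul_assoc])
  rw [Nat.card_eq_fintype_card, mul_right_comm, ← h]
  refine Finset.sum_congr rfl fun y _ => ?_
  rw [Representation.char_mul_comm]

/-- The hypothesis encodes irreducibility on `N`. By `sum_conj_mul` each term is an average of
values of `χ` at commutators of `g * n` with `y ∈ G`; summing over `n` first leaves the norm of `χ`
on `G`. -/
theorem sum_coset_mul_inv (χ : Irr G) (N : Subgroup G)
    (h : ∀ x y, ∑ n : N, χ (x * (n * y * (n : G)⁻¹)) = Nat.card N * χ x * χ y / χ 1) (g : G) :
    ∑ n : N, χ (g * n) * χ (g * n)⁻¹ = Nat.card N := by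
  have hG : (Nat.card G : ℂ) ≠ 0 := Nat.cast_ne_zero.mpr Nat.card_pos.ne'
  have h1 := χ.one_ne_zero
  have h2 : ∀ n : N, χ (g * n) * χ (g * n)⁻¹ =
      χ 1 / Nat.card G * ∑ y, χ ((g⁻¹ * y * g) * (n * y⁻¹ * (n : G)⁻¹)) := by
    intro n
    have h3 : ∑ y, χ ((g⁻¹ * y * g) * (n * y⁻¹ * (n : G)⁻¹)) =
        ∑ y, χ (y * (g * n) * y⁻¹ * (g * n)⁻¹) := by
      refine Finset.sum_congr rfl fun y _ => ?_
      rw [← conj χ _ g]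
      group
    rw [h3, sum_conj_mul]
    field_simp
  rw [Finset.sum_congr rfl fun n _ => h2 n, ← Finset.mul_sum, Finset.sum_comm,
    Finset.sum_congr rfl fun y _ => h _ _]
  have h4 : ∀ y, χ (g⁻¹ * y * g) = χ y := fun y => by
    have := conj χ y g⁻¹
    rwa [inv_inv] at this
  have h5 := sum_mul_inv χ
  simp only [h4]
  rw [← Finset.sum_div]
  simp only [mul_assoc]
  rw [← Finset.mul_sum, h5]
  field_simp

end Irr

end CosetSums

/-! ### Gallagher's theorem: products with an extension are irreducible. -/

section Gallagher

variable {G : Type*} [Group G] [Fintype G]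

/-- The restriction of a representation to a subgroup. -/
def restrictRep {V : Type*} [AddCommGroup V] [Module ℂ V] (ρ : Representation ℂ G V)
    (N : Subgroup G) : Representation ℂ N V :=
  ρ.comp N.subtype

/-- A representation extending an irreducible character of `N` is irreducible on `N`. -/
theorem isIrreducible_restrict {V : Type*} [AddCommGroup V] [Module ℂ V] [FiniteDimensional ℂ V]
    (ρ : Representation ℂ G V) {N : Subgroup G} (θ : Irr N)
    (h : ∀ n : N, ρ.character (n : G) = θ n) :
    (restrictRep ρ N).IsIrreducible := by
  apply isIrreducible_of_sum_character
  have : (restrictRep ρ N).character = (θ : N → ℂ) := funext h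
  rw [this]
  exact θ.sum_mul_inv

variable {N : Subgroup G}

theorem sum_conj_of_extends (θ : Irr N) (θ' : Irr G) (h : ∀ n : N, θ' (n : G) = θ n) (x y : G) :
    ∑ n : N, θ' (x * (n * y * (n : G)⁻¹)) = Nat.card N * θ' x * θ' y / θ' 1 := by
  obtain ⟨χ, m, ρ, hρ, rfl⟩ := θ'
  have := isIrreducible_restrict ρ θ h
  rw [Nat.card_eq_fintype_card]
  refine sum_conj_apply ρ (fun n : N => (n : G)) y x
    (eq_smul_one_of_commute (restrictRep ρ N) _ fun g => ?_)
  rw [commute_iff_eq, Finset.sum_mul, Finset.mul_sum]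
  refine Fintype.sum_equiv (Equiv.mulLeft g⁻¹) _ _ fun n => ?_
  change ρ _ * ρ (g : G) = ρ (g : G) * ρ _
  rw [← map_mul, ← map_mul]
  congr 1
  simp [mul_assoc]

variable [N.Normal]

/-- On each coset of `N` the extension has norm one and `η` is constant, so the norm of the product
can be computed coset by coset. -/
theorem exists_irr_mul (θ : Irr N) (θ' : Irr G) (h : ∀ n : N, θ' (n : G) = θ n)
    (η : Irr (G ⧸ N)) :
    ∃ χ : Irr G, ∀ g : G, χ g = θ' g * η (QuotientGroup.mk g) := by
  have hs := θ'.sum_coset_mul_inv N (sum_conj_of_extends θ θ' h)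
  have hη := η.sum_mul_inv
  obtain ⟨χ, m, ρ, hρ, rfl⟩ := θ'
  obtain ⟨η, l, σ, hσ, rfl⟩ := η
  let τ := Representation.tprod ρ (σ.comp (QuotientGroup.mk' N))
  have hτ : ∀ g, τ.character g = ρ.character g * σ.character (QuotientGroup.mk g) := by
    intro g
    rw [Representation.char_tensor]
    rfl
  have : τ.IsIrreducible := by
    apply isIrreducible_of_sum_character
    rw [← Finset.sum_fiberwise Finset.univ (QuotientGroup.mk : G → G ⧸ N)]
    have h1 : ∀ q : G ⧸ N, ∑ g with (QuotientGroup.mk g : G ⧸ N) = q,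
        τ.character g * τ.character g⁻¹ =
        Nat.card N * (σ.character q * σ.character q⁻¹) := by
      intro q
      obtain ⟨g, rfl⟩ := QuotientGroup.mk_surjective q
      rw [← hs g, ← sum_filter_mk_eq N (fun x => ρ.character x * ρ.character x⁻¹) g,
        Finset.sum_mul]
      refine Finset.sum_congr rfl fun x hx => ?_
      rw [hτ, hτ, ← (Finset.mem_filter.mp hx).2, QuotientGroup.mk_inv]
      ring
    rw [Finset.sum_congr rfl fun q _ => h1 q, ← Finset.mul_sum, hη,
      N.card_eq_card_quotient_mul_card_subgroup]
    push_cast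
    ring
  obtain ⟨χ, hχ⟩ := exists_irr_of_isIrreducible τ
  exact ⟨χ, fun g => by rw [hχ]; exact hτ g⟩

theorem resInner_ne_zero (θ : Irr N) (θ' : Irr G) (h : ∀ n : N, θ' (n : G) = θ n)
    (η : Irr (G ⧸ N)) (χ : Irr G) (hχ : ∀ g : G, χ g = θ' g * η (QuotientGroup.mk g)) :
    resInner χ θ ≠ 0 := by
  have h1 : ∀ n : N, χ (n : G) * θ n⁻¹ = η 1 * (θ n * θ n⁻¹) := by
    intro n
    rw [hχ, h, (QuotientGroup.eq_one_iff (n : G)).mpr n.2]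
    ring
  rw [resInner, finsum_eq_sum_of_fintype, Finset.sum_congr rfl fun n _ => h1 n, ← Finset.mul_sum,
    θ.sum_mul_inv]
  have := η.one_ne_zero
  have hN : (Nat.card N : ℂ) ≠ 0 := Nat.cast_ne_zero.mpr Nat.card_pos.ne'
  positivity

end Gallagher

/-! ### From the centre of the group ring of `G` to that of `G ⧸ N`. -/

section QuotientHom

theorem conj_invariant_of_mem_center {G : Type*} [Group G] {N : Subgroup G}
    {z : MonoidAlgebra AlgInt G} (hz : z ∈ Subalgebra.center AlgInt (MonoidAlgebra AlgInt G)) :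
    ∀ n ∈ N, ∀ x, z.coeff (n * x * n⁻¹) = z.coeff x :=
  fun n _ x => (mem_center_iff_coeff_conj z).mp hz n x

variable {G : Type*} [Group G] [Fintype G] {N : Subgroup G} {M : Ideal AlgInt}

/-- The element commutes with the irreducible action of `N`, so Schur's lemma applies although it
need not be central. -/
theorem intAction_of_conj_invariant {V : Type*} [AddCommGroup V] [Module ℂ V]
    [FiniteDimensional ℂ V] (ρ : Representation ℂ G V) [(restrictRep ρ N).IsIrreducible]
    {z : MonoidAlgebra AlgInt G}
    (hz : ∀ n ∈ N, ∀ x, z.coeff (n * x * n⁻¹) = z.coeff x) :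
    intAction ρ z = omega ρ.character z • 1 := by
  have := nontrivial_of_isIrreducible (restrictRep ρ N)
  have h := eq_smul_one_of_commute (restrictRep ρ N) (intAction ρ z) fun n => by
    rw [commute_iff_eq, intAction_apply, Finset.sum_mul, Finset.mul_sum]
    refine Fintype.sum_equiv (MulAut.conj ((n : G)⁻¹)).toEquiv _ _ fun x => ?_
    have h1 : restrictRep ρ N n = ρ (n : G) := rfl
    have h2 := hz (n : G)⁻¹ (inv_mem n.2) x
    simp only [MulEquiv.toEquiv_eq_coe, EquivLike.coe_coe, MulAut.conj_apply]
    rw [h2, smul_mul_assoc, mul_smul_comm, h1, ← map_mul, ← map_mul]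
    congr 2
    group
  rw [intAction_eq_omega_smul ρ _ z h]
  exact h

variable {θ : Irr N} {θ' : Irr G} {z w : MonoidAlgebra AlgInt G}

theorem isIntegral_omega_of_conj_invariant (h : ∀ n : N, θ' (n : G) = θ n)
    (hz : ∀ n ∈ N, ∀ x, z.coeff (n * x * n⁻¹) = z.coeff x) : IsIntegral ℤ (omega θ' z) := by
  obtain ⟨χ, n, ρ, hρ, rfl⟩ := θ'
  have := isIrreducible_restrict ρ θ h
  have := nontrivial_of_isIrreducible ρ
  exact isIntegral_of_intAction_eq ρ z _ (intAction_of_conj_invariant (N := N) ρ hz)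

theorem omega_mem_of_conj_invariant [M.IsPrime] (h : ∀ n : N, θ' (n : G) = θ n)
    (hz : ∀ n ∈ N, ∀ x, z.coeff (n * x * n⁻¹) = z.coeff x) (hM : ∀ x, z.coeff x ∈ M) :
    omega θ' z ∈ coeIdeal M := by
  obtain ⟨χ, n, ρ, hρ, rfl⟩ := θ'
  have := isIrreducible_restrict ρ θ h
  have := nontrivial_of_isIrreducible ρ
  exact mem_coeIdeal_of_intAction_eq ρ z hM _ (intAction_of_conj_invariant (N := N) ρ hz)

theorem omega_mul_of_conj_invariant (h : ∀ n : N, θ' (n : G) = θ n)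
    (hz : ∀ n ∈ N, ∀ x, z.coeff (n * x * n⁻¹) = z.coeff x)
    (hw : ∀ n ∈ N, ∀ x, w.coeff (n * x * n⁻¹) = w.coeff x) :
    omega θ' (z * w) = omega θ' z * omega θ' w := by
  obtain ⟨χ, n, ρ, hρ, rfl⟩ := θ'
  have := isIrreducible_restrict ρ θ h
  have := nontrivial_of_isIrreducible ρ
  apply intAction_eq_omega_smul ρ
  rw [map_mul, intAction_of_conj_invariant (N := N) ρ hz,
    intAction_of_conj_invariant (N := N) ρ hw]
  simp [smul_smul, mul_comm]

theorem omega_finsetSum {ι : Type*} (χ : G → ℂ) (s : Finset ι) (f : ι → MonoidAlgebra AlgInt G) :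
    omega χ (∑ i ∈ s, f i) = ∑ i ∈ s, omega χ (f i) := by
  simp only [omega, MonoidAlgebra.coeff_sum, Finsupp.finsetSum_apply, AddSubmonoidClass.coe_finsetSum,
    Finset.sum_mul]
  rw [Finset.sum_comm, Finset.sum_div]

variable (N) in
/-- The part of an element of the group ring supported on a coset of `N`. -/
noncomputable def cosetPart (z : MonoidAlgebra AlgInt G) (q : G ⧸ N) : MonoidAlgebra AlgInt G :=
  ofFun fun x => if (QuotientGroup.mk x : G ⧸ N) = q then z.coeff x else 0

theorem coeff_cosetPart (z : MonoidAlgebra AlgInt G) (q : G ⧸ N) (x : G) :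
    (cosetPart N z q).coeff x = if (QuotientGroup.mk x : G ⧸ N) = q then z.coeff x else 0 := rfl

theorem omega_cosetPart (χ : G → ℂ) (z : MonoidAlgebra AlgInt G) (q : G ⧸ N) :
    omega χ (cosetPart N z q) =
      (∑ x with (QuotientGroup.mk x : G ⧸ N) = q, (z.coeff x : ℂ) * χ x) / χ 1 := by
  rw [omega, Finset.sum_filter]
  congr 1
  refine Finset.sum_congr rfl fun x _ => ?_
  rw [coeff_cosetPart]
  split_ifs <;> simp

variable [N.Normal]

theorem cosetPart_conj_invariant (hz : ∀ n ∈ N, ∀ x, z.coeff (n * x * n⁻¹) = z.coeff x)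
    (q : G ⧸ N) :
    ∀ n ∈ N, ∀ x, (cosetPart N z q).coeff (n * x * n⁻¹) = (cosetPart N z q).coeff x := by
  intro n hn x
  have h1 : (QuotientGroup.mk n : G ⧸ N) = 1 := (QuotientGroup.eq_one_iff n).mpr hn
  rw [coeff_cosetPart, coeff_cosetPart, hz n hn, QuotientGroup.mk_mul, QuotientGroup.mk_mul,
    QuotientGroup.mk_inv, h1, inv_one, one_mul, mul_one]

variable (N) in
/-- The map from the centre of the group ring of `G` to that of `G ⧸ N` determined by an
extension `θ'` to `G` of an irreducible character of `N`. -/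
noncomputable def quotientHom (θ' : Irr G) (z : MonoidAlgebra AlgInt G) :
    MonoidAlgebra AlgInt (G ⧸ N) :=
  -- For central `z` and `θ'` extending an irreducible character of `N` the value is always
  -- integral, so the default `0` is not taken.
  ofFun fun q => if h : IsIntegral ℤ (omega θ' (cosetPart N z q)) then ⟨_, h⟩ else 0

theorem coeff_quotientHom (h : ∀ n : N, θ' (n : G) = θ n)
    (hz : z ∈ Subalgebra.center AlgInt (MonoidAlgebra AlgInt G)) (q : G ⧸ N) :
    ((quotientHom N θ' z).coeff q : ℂ) = omega θ' (cosetPart N z q) := by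
  have := isIntegral_omega_of_conj_invariant h
    (cosetPart_conj_invariant (conj_invariant_of_mem_center hz) q)
  rw [quotientHom, coeff_ofFun, dif_pos this]

theorem quotientHom_mem_center (h : ∀ n : N, θ' (n : G) = θ n)
    (hz : z ∈ Subalgebra.center AlgInt (MonoidAlgebra AlgInt G)) :
    quotientHom N θ' z ∈ Subalgebra.center AlgInt (MonoidAlgebra AlgInt (G ⧸ N)) := by
  rw [mem_center_iff_coeff_conj]
  intro r q
  obtain ⟨g, rfl⟩ := QuotientGroup.mk_surjective r
  apply Subtype.ext
  rw [coeff_quotientHom h hz, coeff_quotientHom h hz, omega, omega]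
  congr 1
  symm
  refine Fintype.sum_equiv (MulAut.conj g).toEquiv _ _ fun x => ?_
  simp only [MulEquiv.toEquiv_eq_coe, EquivLike.coe_coe, MulAut.conj_apply, coeff_cosetPart]
  rw [Irr.conj, (mem_center_iff_coeff_conj z).mp hz, QuotientGroup.mk_mul, QuotientGroup.mk_mul,
    QuotientGroup.mk_inv]
  simp only [mul_left_inj, mul_right_inj]

theorem coeff_quotientHom_mem [M.IsPrime] (h : ∀ n : N, θ' (n : G) = θ n)
    (hz : z ∈ Subalgebra.center AlgInt (MonoidAlgebra AlgInt G)) (hM : ∀ x, z.coeff x ∈ M)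
    (q : G ⧸ N) : (quotientHom N θ' z).coeff q ∈ M := by
  rw [← coe_mem_coeIdeal, coeff_quotientHom h hz]
  refine omega_mem_of_conj_invariant h
    (cosetPart_conj_invariant (conj_invariant_of_mem_center hz) q) fun x => ?_
  rw [coeff_cosetPart]
  split_ifs
  · exact hM x
  · exact M.zero_mem

/-- Coset parts convolve as in `G ⧸ N`, and `ω_θ'` is multiplicative on `N`-invariant elements. -/
theorem quotientHom_mul (h : ∀ n : N, θ' (n : G) = θ n)
    (hz : z ∈ Subalgebra.center AlgInt (MonoidAlgebra AlgInt G))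
    (hw : w ∈ Subalgebra.center AlgInt (MonoidAlgebra AlgInt G)) :
    quotientHom N θ' (z * w) = quotientHom N θ' z * quotientHom N θ' w := by
  ext q
  rw [coeff_quotientHom h (mul_mem hz hw), coeff_mul_sum_left]
  have h1 : cosetPart N (z * w) q = ∑ r : G ⧸ N, cosetPart N z r * cosetPart N w (r⁻¹ * q) := by
    refine MonoidAlgebra.coeff_injective (Finsupp.ext fun x => ?_)
    rw [MonoidAlgebra.coeff_sum, Finsupp.finsetSum_apply]
    simp only [coeff_cosetPart, coeff_mul_sum_left]
    rw [Finset.sum_comm]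
    have h2 : ∀ y : G, ∑ r : G ⧸ N, ((if (QuotientGroup.mk y : G ⧸ N) = r then z.coeff y else 0) *
        if (QuotientGroup.mk (y⁻¹ * x) : G ⧸ N) = r⁻¹ * q then w.coeff (y⁻¹ * x) else 0) =
        if (QuotientGroup.mk x : G ⧸ N) = q then z.coeff y * w.coeff (y⁻¹ * x) else 0 := by
      intro y
      rw [Finset.sum_eq_single (QuotientGroup.mk y : G ⧸ N)]
      · simp only [if_true, QuotientGroup.mk_mul, QuotientGroup.mk_inv, mul_right_inj, mul_ite,
          mul_zero]
      · intro r _ hr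
        rw [if_neg hr.symm, zero_mul]
      · simp
    simp only [h2]
    split_ifs <;> simp
  rw [h1, omega_finsetSum]
  push_cast
  refine Finset.sum_congr rfl fun r _ => ?_
  rw [omega_mul_of_conj_invariant h
    (cosetPart_conj_invariant (conj_invariant_of_mem_center hz) _)
    (cosetPart_conj_invariant (conj_invariant_of_mem_center hw) _), coeff_quotientHom h hz,
    coeff_quotientHom h hw]

theorem quotientHom_pow (h : ∀ n : N, θ' (n : G) = θ n)
    (hz : z ∈ Subalgebra.center AlgInt (MonoidAlgebra AlgInt G)) (m : ℕ) (hm : 0 < m) :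
    quotientHom N θ' (z ^ m) = quotientHom N θ' z ^ m := by
  induction m, hm using Nat.le_induction with
  | base => simp
  | succ m hm ih => rw [pow_succ, pow_succ, quotientHom_mul h (pow_mem hz m) hz, ih]

theorem omega_mul_eq_omega_quotientHom (h : ∀ n : N, θ' (n : G) = θ n)
    (hz : z ∈ Subalgebra.center AlgInt (MonoidAlgebra AlgInt G)) (η : Irr (G ⧸ N)) (χ : Irr G)
    (hχ : ∀ g : G, χ g = θ' g * η (QuotientGroup.mk g)) :
    omega χ z = omega η (quotientHom N θ' z) := by
  rw [omega, omega, ← Finset.sum_fiberwise Finset.univ (QuotientGroup.mk : G → G ⧸ N), hχ 1,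
    QuotientGroup.mk_one, ← div_div, Finset.sum_div]
  congr 1
  refine Finset.sum_congr rfl fun q _ => ?_
  rw [coeff_quotientHom h hz, omega_cosetPart, div_mul_eq_mul_div, Finset.sum_mul]
  congr 1
  refine Finset.sum_congr rfl fun x hx => ?_
  rw [hχ, (Finset.mem_filter.mp hx).2, mul_assoc]

/-- Multiplication with an extension preserves blocks. -/
theorem bl_mul_eq_of_bl_eq (h : ∀ n : N, θ' (n : G) = θ n) {η₁ η₂ : Irr (G ⧸ N)}
    {χ₁ χ₂ : Irr G} (h₁ : ∀ g : G, χ₁ g = θ' g * η₁ (QuotientGroup.mk g))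
    (h₂ : ∀ g : G, χ₂ g = θ' g * η₂ (QuotientGroup.mk g)) (hη : bl M η₁ = bl M η₂) :
    bl M χ₁ = bl M χ₂ := by
  rw [bl_eq_iff]
  intro g
  have hz := classSum_mem_center g
  rw [← omega_classSum, ← omega_classSum, omega_mul_eq_omega_quotientHom h hz η₁ χ₁ h₁,
    omega_mul_eq_omega_quotientHom h hz η₂ χ₂ h₂]
  exact omega_sub_mem_of_bl_eq hη (quotientHom_mem_center h hz)

end QuotientHom

/-! ### Group theory of `G = D C_G(D)`. -/

section CentralFactor

variable {G : Type*} [Group G]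

/-- `D` is contained in `N` and `G = D C_G(D)`. -/
structure IsCentralFactor (N D : Subgroup G) : Prop where
  le : D ≤ N
  exists_mul : ∀ g : G, ∃ d ∈ D, ∃ c ∈ Subgroup.centralizer (D : Set G), g = d * c

namespace IsCentralFactor

variable {N D : Subgroup G} (hD : IsCentralFactor N D)

include hD

theorem normal : D.Normal := by
  refine ⟨fun e he g => ?_⟩
  obtain ⟨d, hd, c, hc, rfl⟩ := hD.exists_mul g
  have h : e * c = c * e := Subgroup.mem_centralizer_iff.mp hc e he
  have : d * c * e * (d * c)⁻¹ = d * e * d⁻¹ := by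
    rw [mul_assoc d c e, ← h]
    group
  rw [this]
  exact D.mul_mem (D.mul_mem hd he) (D.inv_mem hd)

theorem normal_centralizer : (Subgroup.centralizer (D : Set G)).Normal := by
  refine ⟨fun x hx g => ?_⟩
  have := hD.normal
  rw [Subgroup.mem_centralizer_iff] at hx ⊢
  intro e he
  have h := hx (g⁻¹ * e * g⁻¹⁻¹) (this.conj_mem e he g⁻¹)
  have h2 : e * (g * x * g⁻¹) = g * (g⁻¹ * e * g⁻¹⁻¹ * x) * g⁻¹ := by group
  rw [h2, h]
  group

theorem exists_mul_of_mem {n : G} (hn : n ∈ N) :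
    ∃ d ∈ D, ∃ c ∈ N ⊓ Subgroup.centralizer (D : Set G), n = d * c := by
  obtain ⟨d, hd, c, hc, rfl⟩ := hD.exists_mul n
  exact ⟨d, hd, c, ⟨(N.mul_mem_cancel_left (hD.le hd)).mp hn, hc⟩, rfl⟩

theorem commute_of_mem {z : G} (hz : z ∈ D ⊓ Subgroup.centralizer (D : Set G)) (g : G) :
    Commute z g := by
  obtain ⟨d, hd, c, hc, rfl⟩ := hD.exists_mul g
  have h1 : Commute z d := (Subgroup.mem_centralizer_iff.mp hz.2 d hd).symm
  have h2 : Commute z c := Subgroup.mem_centralizer_iff.mp hc z hz.1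
  exact h1.mul_right h2

theorem normal_inf : (D ⊓ Subgroup.centralizer (D : Set G)).Normal := by
  refine ⟨fun z hz g => ?_⟩
  have h : g * z * g⁻¹ = z := by
    rw [← (hD.commute_of_mem hz g).eq, mul_inv_cancel_right]
  rwa [h]

/-- `G ⧸ C_G(D)` is an image of `D`. With `n = E` this puts all `p`-regular elements into `C_G(D)`.
-/
theorem pow_mem_centralizer {n : ℕ} (h : ∀ d ∈ D, d ^ n = 1) (x : G) :
    x ^ n ∈ Subgroup.centralizer (D : Set G) := by
  have := hD.normal_centralizer
  rw [← QuotientGroup.eq_one_iff (N := Subgroup.centralizer (D : Set G)), QuotientGroup.mk_pow]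
  obtain ⟨d, hd, c, hc, rfl⟩ := hD.exists_mul x
  rw [QuotientGroup.mk_mul, (QuotientGroup.eq_one_iff c).mpr hc, mul_one, ← QuotientGroup.mk_pow,
    h d hd, QuotientGroup.mk_one]

/-- `N C_G(D) = D C_G(D)`, so `C_G(D)` has the same relative index in `N` and in `D`. -/
theorem card_mul_card [Finite G] :
    Nat.card N * Nat.card ↥(D ⊓ Subgroup.centralizer (D : Set G)) =
      Nat.card ↥(N ⊓ Subgroup.centralizer (D : Set G)) * Nat.card D := by
  have := hD.normal_centralizer
  set C := Subgroup.centralizer (D : Set G)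
  have h1 : C.relIndex N = C.relIndex D := by
    have hsup : N ⊔ C = D ⊔ C := by
      apply le_antisymm
      · refine sup_le (fun n hn => ?_) le_sup_right
        obtain ⟨d, hd, c, hc, rfl⟩ := hD.exists_mul_of_mem hn
        exact Subgroup.mul_mem_sup hd hc.2
      · exact sup_le_sup_right hD.le C
    rw [← Subgroup.relIndex_sup_right N C, hsup, Subgroup.relIndex_sup_right]
  have h2 : ∀ K : Subgroup G, Nat.card ↥(K ⊓ C) * C.relIndex K = Nat.card K := by
    intro K
    have h3 := (C.subgroupOf K).card_mul_index
    have h4 : Nat.card ↥(K ⊓ C) = Nat.card (C.subgroupOf K) := by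
      rw [inf_comm, ← Subgroup.subgroupOf_map_subtype]
      exact Nat.card_congr
        ((C.subgroupOf K).equivMapOfInjective _ K.subtype_injective).toEquiv.symm
    rw [h4]
    exact h3
  have h3 := h2 N
  have h4 := h2 D
  rw [← h3, ← h4, h1]
  ring

end IsCentralFactor

theorem card_conjugatesOf_mul_card_centralizer [Finite G] (g : G) :
    Nat.card (conjugatesOf g) * Nat.card (Subgroup.centralizer ({g} : Set G)) = Nat.card G := by
  have := Fintype.ofFinite G
  have h := MulAction.card_orbit_mul_card_stabilizer_eq_card_group (ConjAct G) g
  rw [Subgroup.nat_card_centralizer_nat_card_stabilizer]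
  have h1 : MulAction.orbit (ConjAct G) g = conjugatesOf g := by
    rw [ConjAct.orbit_eq_carrier_conjClasses]
    ext x
    rw [ConjClasses.mem_carrier_iff_mk_eq, ConjClasses.mk_eq_mk_iff_isConj, isConj_comm]
    rfl
  rw [← h1]
  simp only [← Nat.card_eq_fintype_card] at h
  exact h

end CentralFactor

/-! ### `p`-regular elements, described through the exponent `E`. -/

section Regular

variable {G : Type*} [Group G] {p E : ℕ}

namespace IsRegularExponent

variable (hE : IsRegularExponent p E G)

include hE

theorem pow_pow_eq (x : G) (n : ℕ) (hn : 0 < n) : x ^ E ^ n = x ^ E := by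
  induction n, hn using Nat.le_induction with
  | base => simp
  | succ n _ ih => rw [pow_succ, pow_mul, ih, hE.pow_pow]

theorem pow_eq_one_of_isPGroup {D : Subgroup G} (hD : IsPGroup p D) {z : G} (hz : z ∈ D) :
    z ^ E = 1 := by
  obtain ⟨k, hk, hEk⟩ := hE.exists_eq_pow
  obtain ⟨j, hj⟩ := hD ⟨z, hz⟩
  have hj' : z ^ p ^ j = 1 := congrArg Subtype.val hj
  rw [← hE.pow_pow_eq z (j + 1) j.succ_pos, hEk, ← pow_mul]
  have : j ≤ k * (j + 1) := by nlinarith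
  exact pow_eq_one_iff_modEq.mpr ((Nat.modEq_zero_iff_dvd.mpr
    ((orderOf_dvd_of_pow_eq_one hj').trans (pow_dvd_pow p this))))

theorem mem_centralizer_of_pow_eq {N D : Subgroup G} (hD : IsCentralFactor N D)
    (hDp : IsPGroup p D) {x : G} (hx : x ^ E = x) : x ∈ Subgroup.centralizer (D : Set G) := by
  rw [← hx]
  exact hD.pow_mem_centralizer (fun d hd => hE.pow_eq_one_of_isPGroup hDp hd) x

theorem quotient (N : Subgroup G) [N.Normal] : IsRegularExponent p E (G ⧸ N) := by
  refine ⟨hE.exists_eq_pow, fun q => ?_⟩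
  obtain ⟨g, rfl⟩ := QuotientGroup.mk_surjective q
  rw [← QuotientGroup.mk_pow, ← QuotientGroup.mk_pow, hE.pow_pow]

end IsRegularExponent

end Regular

/-! ### The restriction of `θ'` to `C_G(D)`. -/

section CentralizerCharacter

variable {G : Type*} [Group G] [Fintype G] {N D : Subgroup G} {θ : Irr N} {θ' : Irr G}

/-- As `N = D (N ∩ C_G(D))`, it suffices to commute with both factors: every conjugate of `y` in the
sum centralises `D`, and `N ∩ C_G(D) ≤ H` permutes the summands. Both extreme choices of `H` are
needed later. -/
theorem sum_conj_eq_smul_one {V : Type*} [AddCommGroup V] [Module ℂ V] [FiniteDimensional ℂ V]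
    (hD : IsCentralFactor N D) (ρ : Representation ℂ G V) [(restrictRep ρ N).IsIrreducible]
    (H : Subgroup G) (h₁ : N ⊓ Subgroup.centralizer (D : Set G) ≤ H)
    (h₂ : H ≤ Subgroup.centralizer (D : Set G)) {y : G}
    (hy : y ∈ Subgroup.centralizer (D : Set G)) :
    ∑ c : H, ρ (c * y * (c : G)⁻¹) =
      (LinearMap.trace ℂ V (∑ c : H, ρ (c * y * (c : G)⁻¹)) / Module.finrank ℂ V) • 1 := by
  refine eq_smul_one_of_commute (restrictRep ρ N) _ fun n => ?_
  obtain ⟨d, hd, c, hc, hn⟩ := hD.exists_mul_of_mem n.2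
  have hρn : restrictRep ρ N n = ρ d * ρ c := by
    rw [← map_mul, ← hn]
    rfl
  rw [hρn]
  refine Commute.mul_right ?_ ?_
  · refine Commute.sum_left _ _ _ fun k _ => ?_
    have hk : k * y * (k : G)⁻¹ ∈ Subgroup.centralizer (D : Set G) :=
      mul_mem (mul_mem (h₂ k.2) hy) (inv_mem (h₂ k.2))
    have h3 := Subgroup.mem_centralizer_iff.mp hk d hd
    rw [commute_iff_eq, ← map_mul, ← map_mul, h3]
  · rw [commute_iff_eq, Finset.sum_mul, Finset.mul_sum]
    refine Fintype.sum_equiv (Equiv.mulLeft (⟨c, h₁ hc⟩ : H)⁻¹) _ _ fun k => ?_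
    rw [← map_mul, ← map_mul]
    congr 1
    simp [mul_assoc]

theorem sum_conj_of_le_centralizer (hD : IsCentralFactor N D) (h : ∀ n : N, θ' (n : G) = θ n)
    (H : Subgroup G) (h₁ : N ⊓ Subgroup.centralizer (D : Set G) ≤ H)
    (h₂ : H ≤ Subgroup.centralizer (D : Set G)) (x : G) {y : G}
    (hy : y ∈ Subgroup.centralizer (D : Set G)) :
    ∑ c : H, θ' (x * (c * y * (c : G)⁻¹)) = Nat.card H * θ' x * θ' y / θ' 1 := by
  obtain ⟨χ, m, ρ, hρ, rfl⟩ := θ'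
  have := isIrreducible_restrict ρ θ h
  rw [Nat.card_eq_fintype_card]
  exact sum_conj_apply ρ (fun c : H => (c : G)) y x (sum_conj_eq_smul_one hD ρ H h₁ h₂ hy)

theorem exists_irr_sum_ne_zero (C : Subgroup G) (θ' : Irr G) :
    ∃ σ : Irr C, ∑ x : C, σ x⁻¹ * θ' x ≠ 0 := by
  by_contra! hσ
  let a : MonoidAlgebra ℂ C := ofFun fun x => θ' (x : G)⁻¹
  have ha : a = 0 := by
    apply eq_zero_of_asAlgebraHom_eq_zero
    intro n ρ hρ
    have := nontrivial_of_isIrreducible ρ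
    have hasum : ρ.asAlgebraHom a = ∑ x : C, θ' (x : G)⁻¹ • ρ x := by
      rw [Representation.asAlgebraHom_def, MonoidAlgebra.lift_apply,
        Finsupp.sum_fintype _ _ (by simp)]
      rfl
    rw [eq_smul_one_of_commute ρ (ρ.asAlgebraHom a) fun g => ?_]
    · have h1 := hσ ⟨ρ.character, n, ρ, hρ, rfl⟩
      have h2 : LinearMap.trace ℂ _ (ρ.asAlgebraHom a) = 0 := by
        rw [hasum, map_sum, ← h1]
        refine Fintype.sum_equiv (Equiv.inv C) _ _ fun x => ?_
        rw [map_smul, smul_eq_mul, mul_comm]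
        simp [Representation.character]
      rw [h2]
      simp
    · rw [commute_iff_eq, hasum, Finset.sum_mul, Finset.mul_sum]
      refine Fintype.sum_equiv (MulAut.conj g⁻¹).toEquiv _ _ fun x => ?_
      simp only [MulEquiv.toEquiv_eq_coe, EquivLike.coe_coe, MulAut.conj_apply]
      rw [smul_mul_assoc, mul_smul_comm, ← map_mul, ← map_mul]
      have h3 := Irr.conj θ' (x : G)⁻¹ (g : G)⁻¹
      congr 1
      · rw [← h3]
        push_cast
        group
      · congr 1
        group
  have h1 := congrArg (fun t => t.coeff 1) ha
  simp only [a, coeff_ofFun] at h1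
  apply θ'.one_ne_zero
  simpa using h1

/-- Take a constituent `σ` of the restriction. Evaluating one double sum over `C_G(D)` by the
averaging identity for `θ'` and by that for `σ` gives `σ y / σ 1 = θ' y / θ' 1`. -/
theorem exists_irr_centralizer (hD : IsCentralFactor N D) (h : ∀ n : N, θ' (n : G) = θ n) :
    ∃ σ : Irr (Subgroup.centralizer (D : Set G)),
      ∀ y : Subgroup.centralizer (D : Set G), σ y = σ 1 / θ' 1 * θ' (y : G) := by
  set C := Subgroup.centralizer (D : Set G)
  obtain ⟨σ, hσ⟩ := exists_irr_sum_ne_zero C θ'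
  refine ⟨σ, fun y => ?_⟩
  have h1 : ∑ x : C, σ x⁻¹ * ∑ c : C, θ' (x * (c * y * (c : G)⁻¹)) =
      Nat.card C * (θ' y / θ' 1) * ∑ x : C, σ x⁻¹ * θ' x := by
    rw [Finset.mul_sum]
    refine Finset.sum_congr rfl fun x _ => ?_
    rw [sum_conj_of_le_centralizer hD h C inf_le_right le_rfl _ y.2]
    ring
  have h2 : ∑ x : C, σ x⁻¹ * ∑ c : C, θ' (x * (c * y * (c : G)⁻¹)) =
      Nat.card C * (σ y / σ 1) * ∑ x : C, σ x⁻¹ * θ' x := by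
    simp only [Finset.mul_sum]
    rw [Finset.sum_comm]
    have h3 : ∀ c : C, ∑ x : C, σ x⁻¹ * θ' (x * (c * y * (c : G)⁻¹)) =
        ∑ x : C, σ (c * y * c⁻¹ * x⁻¹) * θ' x := by
      intro c
      refine Fintype.sum_equiv (Equiv.mulRight (c * y * c⁻¹)) _ _ fun x => ?_
      simp [mul_assoc]
    rw [Finset.sum_congr rfl fun c _ => h3 c, Finset.sum_comm]
    refine Finset.sum_congr rfl fun x _ => ?_
    rw [← Finset.sum_mul, σ.sum_conj_mul]
    ring
  have hC : (Nat.card C : ℂ) ≠ 0 := Nat.cast_ne_zero.mpr Nat.card_pos.ne'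
  have h4 := mul_right_cancel₀ hσ (h1.symm.trans h2)
  have h5 := mul_left_cancel₀ hC h4
  have h6 := σ.one_ne_zero
  rw [div_mul_eq_mul_div, mul_div_assoc, h5]
  field_simp

/-- `φ` is a multiple of `θ'` whose restriction to `C_G(D)` is an irreducible character that
remains irreducible on `N ∩ C_G(D)`. -/
structure IsCentralizerCharacter (N D : Subgroup G) (θ' : Irr G) (φ : G → ℂ) : Prop where
  eq_mul : ∀ x, φ x = φ 1 / θ' 1 * θ' x
  exists_one_eq : ∃ d : ℕ, 0 < d ∧ φ 1 = d
  isIntegral : ∀ c ∈ Subgroup.centralizer (D : Set G), IsIntegral ℤ (φ c)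
  sum_mul_inv : ∀ g ∈ Subgroup.centralizer (D : Set G),
    ∑ n : ↥(N ⊓ Subgroup.centralizer (D : Set G)), φ (g * n) * φ (g * n)⁻¹ =
      Nat.card ↥(N ⊓ Subgroup.centralizer (D : Set G))

theorem exists_isCentralizerCharacter (hD : IsCentralFactor N D)
    (h : ∀ n : N, θ' (n : G) = θ n) : ∃ φ, IsCentralizerCharacter N D θ' φ := by
  let C := Subgroup.centralizer (D : Set G)
  obtain ⟨σ, hσ⟩ : ∃ σ : Irr C, ∀ y : C, σ y = σ 1 / θ' 1 * θ' (y : G) :=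
    exists_irr_centralizer hD h
  have h1 := θ'.one_ne_zero
  have hφ1 : σ 1 / θ' 1 * θ' 1 = σ 1 := div_mul_cancel₀ _ h1
  refine ⟨fun x => σ 1 / θ' 1 * θ' x, fun x => by rw [hφ1], ?_, ?_, ?_⟩
  · rw [hφ1]
    exact σ.exists_one_eq
  · intro c hc
    rw [← hσ ⟨c, hc⟩]
    exact σ.isIntegral _
  · intro g hg
    let e : ↥(N ⊓ C) ≃ N.subgroupOf C :=
      { toFun := fun n => ⟨⟨n, n.2.2⟩, n.2.1⟩
        invFun := fun n => ⟨n.1.1, n.2, n.1.2⟩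
        left_inv := fun _ => rfl
        right_inv := fun _ => rfl }
    have h2 : ∀ x y : C, ∑ n : N.subgroupOf C, σ (x * (n * y * (n : C)⁻¹)) =
        Nat.card (N.subgroupOf C) * σ x * σ y / σ 1 := by
      intro x y
      have h3 := sum_conj_of_le_centralizer hD h (N ⊓ C) le_rfl inf_le_right x y.2
      have h4 : ∀ n : ↥(N ⊓ C), σ (x * ((e n : C) * y * (e n : C)⁻¹)) =
          σ 1 / θ' 1 * θ' (x * (n * y * (n : G)⁻¹)) := fun n => hσ _
      rw [← e.sum_comp, Finset.sum_congr rfl fun n _ => h4 n, ← Finset.mul_sum, h3, hσ x, hσ y, Nat.card_congr e]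
      have := σ.one_ne_zero
      field_simp
    have h3 := σ.sum_coset_mul_inv (N.subgroupOf C) h2 ⟨g, hg⟩
    rw [← Nat.card_congr e] at h3
    rw [← h3]
    refine Fintype.sum_equiv e _ _ fun n => ?_
    rw [hσ (⟨g, hg⟩ * (e n : C)), hσ (⟨g, hg⟩ * (e n : C))⁻¹]
    rfl

end CentralizerCharacter

/-! ### Integrality and congruences for the values of `φ`. -/

section LocalAnalysis

variable {G : Type*} [Group G] {N D : Subgroup G} {θ : Irr N} {θ' : Irr G}
  {φ : G → ℂ} {M : Ideal AlgInt} {p E : ℕ}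

theorem apply_eq_smul_one_of_mem_center (hD : IsCentralFactor N D) {V : Type*} [AddCommGroup V]
    [Module ℂ V] [FiniteDimensional ℂ V] (ρ : Representation ℂ G V) [ρ.IsIrreducible] {z : G}
    (hz : z ∈ D ⊓ Subgroup.centralizer (D : Set G)) :
    ρ z = (ρ.character z / ρ.character 1) • 1 := by
  rw [Representation.char_one]
  refine eq_smul_one_of_commute ρ (ρ z) fun g => ?_
  rw [commute_iff_eq, ← map_mul, ← map_mul, (hD.commute_of_mem hz g).eq]

theorem Irr.apply_mul_of_mem_center (hD : IsCentralFactor N D) (θ' : Irr G) {z : G}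
    (hz : z ∈ D ⊓ Subgroup.centralizer (D : Set G)) (x : G) :
    θ' (x * z) = θ' z / θ' 1 * θ' x := by
  obtain ⟨χ, m, ρ, hρ, rfl⟩ := θ'
  have h := apply_eq_smul_one_of_mem_center hD ρ hz
  have h1 : ρ (x * z) = (ρ.character z / ρ.character 1) • ρ x := by
    rw [map_mul]
    conv_lhs => rw [h]
    rw [mul_smul_comm, mul_one]
  change LinearMap.trace ℂ _ (ρ (x * z)) = _ * LinearMap.trace ℂ _ (ρ x)
  rw [h1, map_smul, smul_eq_mul]

theorem centralValue_mul (hD : IsCentralFactor N D) (θ' : Irr G) (z : G) {w : G}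
    (hw : w ∈ D ⊓ Subgroup.centralizer (D : Set G)) :
    θ' (z * w) / θ' 1 = θ' z / θ' 1 * (θ' w / θ' 1) := by
  rw [θ'.apply_mul_of_mem_center hD hw]
  ring

theorem centralValue_inv_mul (hD : IsCentralFactor N D) (θ' : Irr G) {z : G}
    (hz : z ∈ D ⊓ Subgroup.centralizer (D : Set G)) :
    θ' z⁻¹ / θ' 1 * (θ' z / θ' 1) = 1 := by
  rw [← centralValue_mul hD θ' _ hz, inv_mul_cancel, div_self θ'.one_ne_zero]

theorem centralValue_pow (hD : IsCentralFactor N D) (θ' : Irr G) {z : G}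
    (hz : z ∈ D ⊓ Subgroup.centralizer (D : Set G)) (n : ℕ) :
    (θ' z / θ' 1) ^ n = θ' (z ^ n) / θ' 1 := by
  induction n with
  | zero => rw [pow_zero, pow_zero, div_self θ'.one_ne_zero]
  | succ n ih => rw [pow_succ, pow_succ, ih, centralValue_mul hD θ' _ hz]

/-- The value is an `E`-th root of unity, and raising to a power of `p` is injective modulo `M`. -/
theorem centralValue_sub_one_mem [hM : M.IsPrime] [Fact p.Prime] (hpM : (p : AlgInt) ∈ M)
    (hE : IsRegularExponent p E G) (hD : IsCentralFactor N D) (hDp : IsPGroup p D) (θ' : Irr G)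
    {z : G} (hz : z ∈ D ⊓ Subgroup.centralizer (D : Set G)) :
    IsIntegral ℤ (θ' z / θ' 1) ∧ θ' z / θ' 1 - 1 ∈ coeIdeal M := by
  obtain ⟨k, hk, hEk⟩ := hE.exists_eq_pow
  have h1 : (θ' z / θ' 1) ^ E = 1 := by
    rw [centralValue_pow hD θ' hz, hE.pow_eq_one_of_isPGroup hDp hz.1, div_self θ'.one_ne_zero]
  have hE0 : 0 < E := by
    rw [hEk]
    exact pow_pos (Fact.out : p.Prime).pos k
  have h2 : IsIntegral ℤ (θ' z / θ' 1) := IsIntegral.of_pow hE0 (h1 ▸ isIntegral_one)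
  refine ⟨h2, sub_mem_coeIdeal_of_pow_sub_pow_mem (p := p) (k := k) hpM h2 isIntegral_one ?_⟩
  rw [← hEk, h1, one_pow, sub_self]
  exact Submodule.zero_mem _

namespace IsCentralizerCharacter

variable [Fintype G] (hφ : IsCentralizerCharacter N D θ' φ)

include hφ

theorem one_ne_zero : φ 1 ≠ 0 := by
  obtain ⟨d, hd, h⟩ := hφ.exists_one_eq
  rw [h]
  exact_mod_cast hd.ne'

theorem div_one_eq (x : G) : φ x / φ 1 = θ' x / θ' 1 := by
  have := hφ.one_ne_zero
  rw [hφ.eq_mul x]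
  field_simp

theorem conj (x g : G) : φ (g * x * g⁻¹) = φ x := by
  rw [hφ.eq_mul, Irr.conj, ← hφ.eq_mul]

theorem mul_comm (x y : G) : φ (x * y) = φ (y * x) := by
  rw [hφ.eq_mul, Irr.mul_comm, ← hφ.eq_mul]

theorem apply_mul_of_mem_center (hD : IsCentralFactor N D) {z : G}
    (hz : z ∈ D ⊓ Subgroup.centralizer (D : Set G)) (x : G) :
    φ (x * z) = θ' z / θ' 1 * φ x := by
  rw [hφ.eq_mul (x * z), θ'.apply_mul_of_mem_center hD hz, hφ.eq_mul x]
  ring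

theorem inv_mul_self_mul (hD : IsCentralFactor N D) {z : G}
    (hz : z ∈ D ⊓ Subgroup.centralizer (D : Set G)) (x : G) :
    φ (x * z)⁻¹ * φ (x * z) = φ x⁻¹ * φ x := by
  rw [mul_inv_rev, hφ.mul_comm, hφ.apply_mul_of_mem_center hD (inv_mem hz),
    hφ.apply_mul_of_mem_center hD hz]
  linear_combination φ x⁻¹ * φ x * centralValue_inv_mul hD θ' hz

/-- The element of the integral group ring with coefficients `φ(x⁻¹)` on `X`. -/
theorem exists_coeff_eq (X : G → Prop)
    (hX : ∀ x, X x → x ∈ Subgroup.centralizer (D : Set G)) :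
    ∃ w : MonoidAlgebra AlgInt G, ∀ x, (w.coeff x : ℂ) = if X x then φ x⁻¹ else 0 := by
  refine ⟨ofFun fun x => if hx : X x then ⟨φ x⁻¹, hφ.isIntegral _ (inv_mem (hX x hx))⟩ else 0,
    fun x => ?_⟩
  rw [coeff_ofFun]
  split_ifs <;> rfl

theorem omega_eq {X : G → Prop} {w : MonoidAlgebra AlgInt G}
    (hw : ∀ x, (w.coeff x : ℂ) = if X x then φ x⁻¹ else 0) :
    omega θ' w = (∑ x with X x, φ x⁻¹ * φ x) / φ 1 := by
  rw [omega, Finset.sum_div, Finset.sum_div, Finset.sum_filter]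
  refine Finset.sum_congr rfl fun x _ => ?_
  rw [hw]
  split_ifs
  · rw [mul_div_assoc, mul_div_assoc, hφ.div_one_eq]
  · simp

/-- The terms `φ(x⁻¹) ρ(x)` are constant on cosets of the central subgroup `D ∩ C_G(D)`. Keeping one
representative per coset divides the scalar by the order of this subgroup while the coefficients
stay integral; the denominator in the later congruences comes from here. -/
theorem exists_intAction_eq (hD : IsCentralFactor N D) {V : Type*} [AddCommGroup V] [Module ℂ V]
    [FiniteDimensional ℂ V] (ρ : Representation ℂ G V) [ρ.IsIrreducible]
    [(restrictRep ρ N).IsIrreducible] (hρ : ρ.character = θ') (X : G → Prop)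
    (hX : ∀ x, X x → x ∈ Subgroup.centralizer (D : Set G))
    (hXN : ∀ n ∈ N, ∀ x, X (n * x * n⁻¹) ↔ X x)
    (hXZ : ∀ z ∈ D ⊓ Subgroup.centralizer (D : Set G), ∀ x, X (x * z) ↔ X x) :
    ∃ w : MonoidAlgebra AlgInt G, (∀ x, w.coeff x ≠ 0 → ∃ y, X y ∧ (w.coeff x : ℂ) = φ y⁻¹) ∧
      intAction ρ w = ((∑ x with X x, φ x⁻¹ * φ x) /
        (Nat.card ↥(D ⊓ Subgroup.centralizer (D : Set G)) * φ 1)) • 1 := by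
  set Z := D ⊓ Subgroup.centralizer (D : Set G)
  obtain ⟨a, ha⟩ := hφ.exists_coeff_eq X hX
  have hinv : ∀ n ∈ N, ∀ x, a.coeff (n * x * n⁻¹) = a.coeff x := by
    intro n hn x
    apply Subtype.ext
    rw [ha, ha]
    simp only [hXN n hn]
    have h1 : (n * x * n⁻¹)⁻¹ = n * x⁻¹ * n⁻¹ := by group
    rw [h1, hφ.conj]
  have h1 := intAction_of_conj_invariant (N := N) ρ hinv
  rw [hρ, hφ.omega_eq ha, intAction_apply, sum_eq_card_smul_sum_out Z] at h1
  · let w : MonoidAlgebra AlgInt G := ofFun fun x => if (QuotientGroup.mk x : G ⧸ Z).out = x then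
      a.coeff x else 0
    refine ⟨w, ?_, ?_⟩
    · intro x hx
      simp only [w, coeff_ofFun] at hx ⊢
      split_ifs at hx ⊢ with h2
      · refine ⟨x, ?_, ?_⟩
        · by_contra h3
          apply hx
          apply Subtype.ext
          rw [ha, if_neg h3]
          rfl
        · rw [ha, if_pos]
          by_contra h3
          apply hx
          apply Subtype.ext
          rw [ha, if_neg h3]
          rfl
      · exact absurd rfl hx
    · have h2 : intAction ρ w = ∑ q : G ⧸ Z, (a.coeff q.out : ℂ) • ρ q.out := by
        rw [intAction_apply]
        symm
        refine Finset.sum_of_injOn (fun q : G ⧸ Z => q.out) ?_ ?_ ?_ ?_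
        · exact fun q _ r _ hqr => Quotient.out_injective hqr
        · exact fun _ _ => Finset.mem_coe.mpr (Finset.mem_univ _)
        · intro x _ hx
          simp only [w, coeff_ofFun]
          rw [if_neg]
          · simp
          · intro h3
            exact hx ⟨QuotientGroup.mk x, by simp, h3⟩
        · intro q _
          simp only [w, coeff_ofFun]
          rw [QuotientGroup.out_eq', if_pos rfl]
      have hZ : (Nat.card Z : ℂ) ≠ 0 := Nat.cast_ne_zero.mpr Nat.card_pos.ne'
      have hd := hφ.one_ne_zero
      rw [h2]
      have h3 := congrArg (fun t => (Nat.card Z : ℂ)⁻¹ • t) h1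
      simp only [← Nat.cast_smul_eq_nsmul ℂ, smul_smul, inv_mul_cancel₀ hZ, one_smul] at h3
      rw [h3]
      congr 1
      field_simp
  · intro g z hz
    rw [map_mul ρ, apply_eq_smul_one_of_mem_center hD ρ hz, mul_smul_comm, mul_one, smul_smul, ha,
      ha, hρ]
    congr 1
    simp only [hXZ z hz]
    split_ifs
    · rw [mul_inv_rev, hφ.mul_comm, hφ.apply_mul_of_mem_center hD (inv_mem hz)]
      linear_combination φ g⁻¹ * centralValue_inv_mul hD θ' hz
    · simp

theorem isIntegral_sum_div (hD : IsCentralFactor N D) (h : ∀ n : N, θ' (n : G) = θ n)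
    (X : G → Prop) (hX : ∀ x, X x → x ∈ Subgroup.centralizer (D : Set G))
    (hXN : ∀ n ∈ N, ∀ x, X (n * x * n⁻¹) ↔ X x)
    (hXZ : ∀ z ∈ D ⊓ Subgroup.centralizer (D : Set G), ∀ x, X (x * z) ↔ X x) :
    IsIntegral ℤ ((∑ x with X x, φ x⁻¹ * φ x) /
        (Nat.card ↥(D ⊓ Subgroup.centralizer (D : Set G)) * φ 1)) := by
  obtain ⟨χ, m, ρ, hρ, rfl⟩ := θ'
  have := isIrreducible_restrict ρ θ h
  have := nontrivial_of_isIrreducible ρ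
  obtain ⟨w, -, hw⟩ := hφ.exists_intAction_eq hD ρ rfl X hX hXN hXZ
  exact isIntegral_of_intAction_eq ρ w _ hw

theorem sum_div_mem [M.IsPrime] (hD : IsCentralFactor N D) (h : ∀ n : N, θ' (n : G) = θ n)
    (X : G → Prop) (hX : ∀ x, X x → x ∈ Subgroup.centralizer (D : Set G))
    (hXN : ∀ n ∈ N, ∀ x, X (n * x * n⁻¹) ↔ X x)
    (hXZ : ∀ z ∈ D ⊓ Subgroup.centralizer (D : Set G), ∀ x, X (x * z) ↔ X x)
    (hXM : ∀ x, X x → φ x⁻¹ ∈ coeIdeal M) :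
    (∑ x with X x, φ x⁻¹ * φ x) /
        (Nat.card ↥(D ⊓ Subgroup.centralizer (D : Set G)) * φ 1) ∈ coeIdeal M := by
  obtain ⟨χ, m, ρ, hρ, rfl⟩ := θ'
  have := isIrreducible_restrict ρ θ h
  have := nontrivial_of_isIrreducible ρ
  obtain ⟨w, hwM, hw⟩ := hφ.exists_intAction_eq hD ρ rfl X hX hXN hXZ
  refine mem_coeIdeal_of_intAction_eq ρ w (fun x => ?_) _ hw
  by_cases hx : w.coeff x = 0
  · rw [hx]
    exact M.zero_mem
  · obtain ⟨y, hy, hxy⟩ := hwM x hx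
    rw [← coe_mem_coeIdeal, hxy]
    exact hXM y hy

theorem sum_coset [N.Normal] {g : G} (hg : g ∈ Subgroup.centralizer (D : Set G)) :
    ∑ x with (x ∈ Subgroup.centralizer (D : Set G) ∧
        (QuotientGroup.mk x : G ⧸ N) = QuotientGroup.mk g), φ x⁻¹ * φ x =
      Nat.card ↥(N ⊓ Subgroup.centralizer (D : Set G)) := by
  rw [← hφ.sum_mul_inv g hg]
  symm
  refine Finset.sum_bij (fun n _ => g * (n : G)) ?_ ?_ ?_ ?_
  · intro n _
    rw [Finset.mem_filter]
    refine ⟨Finset.mem_univ _, mul_mem hg n.2.2, ?_⟩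
    simpa using n.2.1
  · intro n _ m _ hnm
    exact Subtype.ext (mul_left_cancel hnm)
  · intro x hx
    obtain ⟨-, hxC, hxg⟩ := Finset.mem_filter.mp hx
    have h1 : g⁻¹ * x ∈ N := QuotientGroup.eq.mp hxg.symm
    have h2 : g⁻¹ * x ∈ Subgroup.centralizer (D : Set G) := mul_mem (inv_mem hg) hxC
    exact ⟨⟨g⁻¹ * x, h1, h2⟩, Finset.mem_univ _, by simp⟩
  · intro n _
    exact _root_.mul_comm _ _

theorem sum_inf :
    ∑ x with x ∈ N ⊓ Subgroup.centralizer (D : Set G), φ x⁻¹ * φ x =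
      Nat.card ↥(N ⊓ Subgroup.centralizer (D : Set G)) := by
  rw [← hφ.sum_mul_inv 1 (one_mem _)]
  rw [Finset.sum_subtype (p := fun x => x ∈ N ⊓ Subgroup.centralizer (D : Set G)) _ (by simp)]
  exact Finset.sum_congr rfl fun n _ => by rw [one_mul, _root_.mul_comm]

theorem isIntegral_card_div [N.Normal] (hD : IsCentralFactor N D)
    (h : ∀ n : N, θ' (n : G) = θ n) :
    IsIntegral ℤ ((Nat.card ↥(N ⊓ Subgroup.centralizer (D : Set G)) : ℂ) /
        (Nat.card ↥(D ⊓ Subgroup.centralizer (D : Set G)) * φ 1)) := by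
  have := hD.normal_centralizer
  rw [← hφ.sum_inf]
  refine hφ.isIntegral_sum_div hD h _ (fun x hx => hx.2) (fun n hn x => ?_) fun z hz x => ?_
  · constructor
    · intro hx
      have h1 := (inferInstance : (N ⊓ Subgroup.centralizer (D : Set G)).Normal).conj_mem _ hx n⁻¹
      have h2 : n⁻¹ * (n * x * n⁻¹) * n⁻¹⁻¹ = x := by group
      rwa [h2] at h1
    · intro hx
      exact (inferInstance : (N ⊓ Subgroup.centralizer (D : Set G)).Normal).conj_mem _ hx n
  · exact Subgroup.mul_mem_cancel_right _ ⟨hD.le hz.1, hz.2⟩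

/-- This is the scalar by which the sum of the distinct conjugates of `x` under `N ∩ C_G(D)` acts on
`θ'`. -/
theorem isIntegral_class_sum (hD : IsCentralFactor N D) (h : ∀ n : N, θ' (n : G) = θ n) {x : G}
    (hx : x ∈ Subgroup.centralizer (D : Set G)) :
    IsIntegral ℤ ((Nat.card ↥(N ⊓ Subgroup.centralizer (D : Set G)) : ℂ) * φ x /
      (Nat.card ↥(N ⊓ Subgroup.centralizer (D : Set G) ⊓ Subgroup.centralizer {x}) * φ 1)) := by
  have hdiv := hφ.div_one_eq x
  obtain ⟨χ, m, ρ, hρ, rfl⟩ := θ'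
  have := isIrreducible_restrict ρ θ h
  have := nontrivial_of_isIrreducible ρ
  set K := N ⊓ Subgroup.centralizer (D : Set G)
  have h1 := sum_conj_eq_smul_one hD ρ K le_rfl inf_le_right hx
  have h2 : LinearMap.trace ℂ (Fin m → ℂ) (∑ c : K, ρ (c * x * (c : G)⁻¹)) =
      Nat.card K * ρ.character x := by
    rw [map_sum]
    have h3 : ∀ c : K, LinearMap.trace ℂ _ (ρ (c * x * (c : G)⁻¹)) = ρ.character x :=
      fun c => Representation.char_conj ρ x c
    rw [Finset.sum_congr rfl fun c _ => h3 c, Finset.sum_const, Finset.card_univ, nsmul_eq_mul,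
      Nat.card_eq_fintype_card]
  let S := (Subgroup.centralizer ({x} : Set G)).subgroupOf K
  have hS : Nat.card S = Nat.card ↥(K ⊓ Subgroup.centralizer ({x} : Set G)) :=
    Nat.card_congr
      { toFun := fun s => ⟨s.1.1, s.1.2, s.2⟩
        invFun := fun s => ⟨⟨s.1, s.2.1⟩, s.2.2⟩
        left_inv := fun _ => rfl
        right_inv := fun _ => rfl }
  rw [h2, sum_eq_card_smul_sum_out S] at h1
  · let w : MonoidAlgebra AlgInt G :=
      ∑ q : K ⧸ S, MonoidAlgebra.single ((q.out : G) * x * (q.out : G)⁻¹) 1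
    have h3 : intAction ρ w = ∑ q : K ⧸ S, ρ ((q.out : G) * x * (q.out : G)⁻¹) := by
      simp only [w, map_sum, intAction, MonoidAlgebra.lift_single, one_smul]
    refine isIntegral_of_intAction_eq ρ w _ ?_
    have hSc : (Nat.card S : ℂ) ≠ 0 := Nat.cast_ne_zero.mpr Nat.card_pos.ne'
    have h4 := congrArg (fun t => (Nat.card S : ℂ)⁻¹ • t) h1
    simp only [← Nat.cast_smul_eq_nsmul ℂ, smul_smul, inv_mul_cancel₀ hSc, one_smul] at h4
    rw [h3, h4, ← hS]
    congr 1
    have h5 : φ x / φ 1 = ρ.character x / Module.finrank ℂ (Fin m → ℂ) := by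
      rw [hdiv, ← Representation.char_one ρ]
    rw [mul_div_assoc, ← h5, mul_div_mul_comm]
    field_simp
  · intro c s hs
    have h3 : (s : G) * x = x * s := (Subgroup.mem_centralizer_iff.mp hs x rfl).symm
    congr 1
    push_cast
    rw [mul_inv_rev, mul_assoc (c : G) s x, h3]
    group

/-- The `p`-part of `x` lies in `S = C_K(x)` for `K = N ∩ C_G(D)`, but not in `Z = D ∩ C_G(D)`, so
`p` divides `|S : Z|`. By `isIntegral_class_sum`, the ratio in `hr` times `φ x` is then `p` times an
algebraic integer, and the ratio cancels modulo `M`. -/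
theorem mem_coeIdeal_of_notMem [N.Normal] [hM : M.IsPrime] [hp : Fact p.Prime]
    (hpM : (p : AlgInt) ∈ M) (hE : IsRegularExponent p E G) (hD : IsCentralFactor N D)
    (h : ∀ n : N, θ' (n : G) = θ n)
    (hr : (Nat.card ↥(N ⊓ Subgroup.centralizer (D : Set G)) : ℂ) /
        (Nat.card ↥(D ⊓ Subgroup.centralizer (D : Set G)) * φ 1) ∉ coeIdeal M)
    {x : G} (hx : x ∈ Subgroup.centralizer (D : Set G)) (hxN : (x ^ E)⁻¹ * x ∈ N)
    (hxD : (x ^ E)⁻¹ * x ∉ D) : φ x ∈ coeIdeal M := by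
  have hα := hφ.isIntegral_class_sum hD h hx
  have hr' := hφ.isIntegral_card_div hD h
  have hxi := hφ.isIntegral x hx
  have hZn := hD.normal_inf
  set K := N ⊓ Subgroup.centralizer (D : Set G)
  set Z := D ⊓ Subgroup.centralizer (D : Set G) with hZ
  set S := K ⊓ Subgroup.centralizer ({x} : Set G)
  obtain ⟨k, hk, hEk⟩ := hE.exists_eq_pow
  have hZS : Z ≤ S := fun z hz => by
    have h1 : z ∈ Subgroup.centralizer ({x} : Set G) := by
      rw [Subgroup.mem_centralizer_iff]
      rintro _ rfl
      exact (hD.commute_of_mem hz _).eq.symm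
    exact ⟨⟨hD.le hz.1, hz.2⟩, h1⟩
  have hcomm : Commute ((x ^ E)⁻¹ * x) x :=
    (((Commute.refl x).pow_left E).inv_left).mul_left (Commute.refl x)
  have huS : (x ^ E)⁻¹ * x ∈ S := by
    have h1 : (x ^ E)⁻¹ * x ∈ Subgroup.centralizer ({x} : Set G) := by
      rw [Subgroup.mem_centralizer_iff]
      rintro _ rfl
      exact hcomm.eq.symm
    have h2 : (x ^ E)⁻¹ * x ∈ Subgroup.centralizer (D : Set G) :=
      mul_mem (inv_mem (pow_mem hx E)) hx
    exact ⟨⟨hxN, h2⟩, h1⟩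
  have huE : ((x ^ E)⁻¹ * x) ^ E = 1 := by
    rw [((Commute.refl x).pow_left E).inv_left.mul_pow, inv_pow, hE.pow_pow, inv_mul_cancel]
  have hdvd : p ∣ (Z.subgroupOf S).index := by
    let u : S ⧸ Z.subgroupOf S := QuotientGroup.mk ⟨_, huS⟩
    have hu1 : u ≠ 1 := by
      intro hu
      exact hxD ((QuotientGroup.eq_one_iff (N := Z.subgroupOf S) _).mp hu).1
    have hup : u ^ p ^ k = 1 := by
      rw [← hEk, ← QuotientGroup.mk_pow]
      have : (⟨_, huS⟩ : S) ^ E = 1 := Subtype.ext huE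
      rw [this, QuotientGroup.mk_one]
    have h1 : p ∣ orderOf u := by
      obtain ⟨j, -, hj⟩ := (Nat.dvd_prime_pow hp.out).mp (orderOf_dvd_of_pow_eq_one hup)
      rw [hj]
      refine dvd_pow_self p ?_
      rintro rfl
      exact hu1 (orderOf_eq_one_iff.mp (by simpa using hj))
    exact h1.trans (orderOf_dvd_natCard u)
  obtain ⟨j, hj⟩ := hdvd
  have hcard : Nat.card S = Nat.card Z * (p * j) := by
    rw [← hj, ← (Z.subgroupOf S).card_mul_index,
      Nat.card_congr (Subgroup.subgroupOfEquivOfLe hZS).toEquiv]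
  have h2 : (Nat.card K : ℂ) / (Nat.card Z * φ 1) * φ x =
      (Nat.card K * φ x / (Nat.card S * φ 1) * j) * p := by
    have h3 : (Nat.card S : ℂ) ≠ 0 := Nat.cast_ne_zero.mpr Nat.card_pos.ne'
    have h4 : (Nat.card Z : ℂ) ≠ 0 := Nat.cast_ne_zero.mpr Nat.card_pos.ne'
    have h5 := hφ.one_ne_zero
    have h6 : (Nat.card S : ℂ) = Nat.card Z * (p * j) := by exact_mod_cast hcard
    field_simp
    rw [h6]
    ring
  have h3 : (Nat.card K : ℂ) / (Nat.card Z * φ 1) * φ x ∈ coeIdeal M := by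
    rw [h2]
    refine mul_mem_coeIdeal (hα.mul ?_) ⟨p, hpM, by simp⟩
    exact_mod_cast isIntegral_algebraMap (R := ℤ) (A := ℂ) (x := j)
  exact (mem_or_mem_of_mul_mem_coeIdeal hr' hxi h3).resolve_left hr

end IsCentralizerCharacter

end LocalAnalysis

/-! ### Sums of `φ(x⁻¹) φ(x)` over the `p`-regular elements of a coset. -/

section RegularSums

variable {G : Type*} [Group G] {N D : Subgroup G} {θ : Irr N} {θ' : Irr G}
  {φ : G → ℂ} {M : Ideal AlgInt} {p E : ℕ}

theorem IsRegularExponent.pow_mul_of_mem_center (hE : IsRegularExponent p E G)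
    (hD : IsCentralFactor N D) (hDp : IsPGroup p D) {z : G}
    (hz : z ∈ D ⊓ Subgroup.centralizer (D : Set G)) (x : G) : (x * z) ^ E = x ^ E := by
  rw [(hD.commute_of_mem hz x).symm.mul_pow, hE.pow_eq_one_of_isPGroup hDp hz.1, mul_one]

theorem pow_inv_mul_mem_iff [D.Normal] (x g : G) (n : ℕ) :
    ((g * x * g⁻¹) ^ n)⁻¹ * (g * x * g⁻¹) ∈ D ↔ (x ^ n)⁻¹ * x ∈ D := by
  have h : ((g * x * g⁻¹) ^ n)⁻¹ * (g * x * g⁻¹) = g * ((x ^ n)⁻¹ * x) * g⁻¹ := by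
    rw [conj_pow]
    group
  rw [h]
  exact (‹D.Normal›.mem_comm_iff).trans (by rw [inv_mul_cancel_left])

namespace IsCentralizerCharacter

variable [Fintype G] (hφ : IsCentralizerCharacter N D θ' φ)

include hφ

/-- The bijection is `(x, z) ↦ x z` with `x` regular and `z ∈ D ∩ C_G(D)`, inverted by splitting off
the `p`-part; the factor `z` does not change `φ(x⁻¹) φ(x)`. -/
theorem sum_section [N.Normal] (hE : IsRegularExponent p E G) (hD : IsCentralFactor N D)
    (hDp : IsPGroup p D) (q : G ⧸ N) :
    ∑ x with (x ∈ Subgroup.centralizer (D : Set G) ∧ (QuotientGroup.mk x : G ⧸ N) = q ∧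
        (x ^ E)⁻¹ * x ∈ D), φ x⁻¹ * φ x =
      Nat.card ↥(D ⊓ Subgroup.centralizer (D : Set G)) *
        ∑ x with ((QuotientGroup.mk x : G ⧸ N) = q ∧ x ^ E = x), φ x⁻¹ * φ x := by
  set Z := D ⊓ Subgroup.centralizer (D : Set G) with hZ
  have h1 : (Nat.card Z : ℂ) * ∑ x with ((QuotientGroup.mk x : G ⧸ N) = q ∧ x ^ E = x),
      φ x⁻¹ * φ x = ∑ a ∈ (Finset.univ.filter fun x =>
        ((QuotientGroup.mk x : G ⧸ N) = q ∧ x ^ E = x)) ×ˢ (Finset.univ : Finset Z),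
      φ a.1⁻¹ * φ a.1 := by
    rw [Finset.sum_product, Finset.mul_sum]
    refine Finset.sum_congr rfl fun x _ => ?_
    simp [Nat.card_eq_fintype_card]
  rw [h1]
  have hmk : ∀ z ∈ Z, ∀ x : G, (QuotientGroup.mk (x * z) : G ⧸ N) = QuotientGroup.mk x := by
    intro z hz x
    rw [QuotientGroup.mk_mul, (QuotientGroup.eq_one_iff z).mpr (hD.le hz.1), mul_one]
  have hu : ∀ x, x ∈ Subgroup.centralizer (D : Set G) → (x ^ E)⁻¹ * x ∈ D →
      (x ^ E)⁻¹ * x ∈ Z := fun x hx hxD => by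
    have h2 : (x ^ E)⁻¹ * x ∈ Subgroup.centralizer (D : Set G) :=
      mul_mem (inv_mem (pow_mem hx E)) hx
    exact ⟨hxD, h2⟩
  symm
  refine Finset.sum_bij (fun a _ => a.1 * (a.2 : G)) ?_ ?_ ?_ ?_
  · rintro ⟨x, z⟩ ha
    obtain ⟨hx, -⟩ := Finset.mem_product.mp ha
    obtain ⟨-, hxq, hxE⟩ := Finset.mem_filter.mp hx
    simp only at hxq hxE ⊢
    rw [Finset.mem_filter, hE.pow_mul_of_mem_center hD hDp z.2, hxE, hmk z z.2,
      inv_mul_cancel_left]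
    exact ⟨Finset.mem_univ _, mul_mem (hE.mem_centralizer_of_pow_eq hD hDp hxE) z.2.2, hxq, z.2.1⟩
  · rintro ⟨x, z⟩ ha ⟨y, w⟩ hb hab
    have hx := (Finset.mem_filter.mp (Finset.mem_product.mp ha).1).2.2
    have hy := (Finset.mem_filter.mp (Finset.mem_product.mp hb).1).2.2
    simp only at hx hy hab
    have h2 := congrArg (fun t => t ^ E) hab
    simp only [hE.pow_mul_of_mem_center hD hDp z.2, hE.pow_mul_of_mem_center hD hDp w.2, hx, hy]
      at h2
    subst h2
    exact Prod.ext rfl (Subtype.ext (mul_left_cancel hab))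
  · intro x hx
    obtain ⟨-, hxC, hxq, hxD⟩ := Finset.mem_filter.mp hx
    have h2 := hu x hxC hxD
    refine ⟨(x ^ E, ⟨_, h2⟩), ?_, by simp⟩
    rw [Finset.mem_product, Finset.mem_filter]
    refine ⟨⟨Finset.mem_univ _, ?_, hE.pow_pow x⟩, Finset.mem_univ _⟩
    rw [← hmk _ h2 (x ^ E), mul_inv_cancel_left, hxq]
  · rintro ⟨x, z⟩ _
    exact (hφ.inv_mul_self_mul hD z.2 x).symm

/-- Over a coset, the elements of `C_G(D)` contribute `|N ∩ C_G(D)|` in total. Those with `p`-part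
in `D` give the regular sum by `sum_section`; the others have `φ(x⁻¹) ∈ M`, and `sum_div_mem` keeps
their contribution in `M` after the division. -/
theorem sum_regular_sub_mem [N.Normal] [M.IsPrime] [Fact p.Prime]
    (hpM : (p : AlgInt) ∈ M) (hE : IsRegularExponent p E G) (hD : IsCentralFactor N D)
    (hDp : IsPGroup p D) (h : ∀ n : N, θ' (n : G) = θ n)
    (hr : (Nat.card ↥(N ⊓ Subgroup.centralizer (D : Set G)) : ℂ) /
        (Nat.card ↥(D ⊓ Subgroup.centralizer (D : Set G)) * φ 1) ∉ coeIdeal M)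
    {q : G ⧸ N} (hq : q ^ E = q) :
    (∑ x with ((QuotientGroup.mk x : G ⧸ N) = q ∧ x ^ E = x), φ x⁻¹ * φ x) / φ 1 -
      (Nat.card ↥(N ⊓ Subgroup.centralizer (D : Set G)) : ℂ) /
        (Nat.card ↥(D ⊓ Subgroup.centralizer (D : Set G)) * φ 1) ∈ coeIdeal M := by
  have hDn := hD.normal
  have hCn := hD.normal_centralizer
  have hZ0 : (Nat.card ↥(D ⊓ Subgroup.centralizer (D : Set G)) : ℂ) ≠ 0 :=
    Nat.cast_ne_zero.mpr Nat.card_pos.ne'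
  have hd := hφ.one_ne_zero
  obtain ⟨g, rfl⟩ := QuotientGroup.mk_surjective q
  -- Since `q` is regular, `g ^ E` represents the same coset, and it lies in `C_G(D)`.
  have hgE : (QuotientGroup.mk (g ^ E) : G ⧸ N) = QuotientGroup.mk g := by
    rw [QuotientGroup.mk_pow, hq]
  have hgC : g ^ E ∈ Subgroup.centralizer (D : Set G) :=
    hD.pow_mem_centralizer (fun d hd => hE.pow_eq_one_of_isPGroup hDp hd) g
  have h1 := hφ.sum_coset hgC
  rw [hgE] at h1
  have h2 := hφ.sum_section hE hD hDp (QuotientGroup.mk g : G ⧸ N)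
  have h3 := hφ.sum_div_mem (M := M) hD h
    (fun x => x ∈ Subgroup.centralizer (D : Set G) ∧
      (QuotientGroup.mk x : G ⧸ N) = QuotientGroup.mk g ∧ (x ^ E)⁻¹ * x ∉ D)
    (fun x hx => hx.1) ?_ ?_ ?_
  · rw [← Finset.sum_filter_add_sum_filter_not _ fun x => (x ^ E)⁻¹ * x ∈ D, Finset.filter_filter,
      Finset.filter_filter] at h1
    simp only [and_assoc] at h1
    rw [h2] at h1
    rw [← neg_mem_iff]
    convert h3 using 1
    rw [← h1]
    field_simp
    ring_nf
    congr!
  · intro n hn x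
    rw [pow_inv_mul_mem_iff x n E, QuotientGroup.mk_mul, QuotientGroup.mk_mul, QuotientGroup.mk_inv,
      (QuotientGroup.eq_one_iff n).mpr hn, inv_one, one_mul, mul_one, hCn.mem_comm_iff,
      inv_mul_cancel_left]
  · intro z hz x
    rw [hE.pow_mul_of_mem_center hD hDp hz, QuotientGroup.mk_mul,
      (QuotientGroup.eq_one_iff z).mpr (hD.le hz.1), mul_one, ← mul_assoc,
      D.mul_mem_cancel_right hz.1, (Subgroup.centralizer (D : Set G)).mul_mem_cancel_right hz.2]
  · rintro x ⟨hxC, hxq, hxD⟩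
    have h4 : (x⁻¹ ^ E)⁻¹ * x⁻¹ = ((x ^ E)⁻¹ * x)⁻¹ := by
      rw [inv_pow, inv_inv, mul_inv_rev, inv_inv]
      exact (((Commute.refl x).pow_left E).inv_right).eq
    refine hφ.mem_coeIdeal_of_notMem hpM hE hD h hr (inv_mem hxC) ?_ ?_
    · rw [h4, inv_mem_iff, ← QuotientGroup.eq_one_iff, QuotientGroup.mk_mul, QuotientGroup.mk_inv,
        QuotientGroup.mk_pow, hxq, hq, inv_mul_cancel]
    · rwa [h4, inv_mem_iff]

end IsCentralizerCharacter

end RegularSums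

/-! ### The defect group puts the ratio outside `M`. -/

section DefectGroup

variable {G : Type*} [Group G] {N : Subgroup G} {D : Subgroup N} {θ : Irr N}
  {θ' : Irr G} {φ : G → ℂ} {M : Ideal AlgInt} {p : ℕ} {b : Bl M N}

theorem IsDefectGroup.isPGroup [Fact p.Prime] (hD : IsDefectGroup p b D) :
    IsPGroup p (D.map N.subtype) := by
  obtain ⟨g, -, P, rfl⟩ := hD
  exact (P.isPGroup'.map _).map _

theorem IsDefectGroup.exists_centralChar [Finite G] [Fact p.Prime] (hD : IsDefectGroup p b D)
    (hθ : bl M θ = b) :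
    ∃ n : N, centralChar θ n ∉ coeIdeal M ∧
      D ≤ Subgroup.centralizer ({n} : Set N) ∧ ∃ j : ℕ, ¬ p ∣ j ∧
      Nat.card (Subgroup.centralizer ({n} : Set N)) = Nat.card D * j := by
  obtain ⟨n, ⟨⟨χ, hχ, r, hr, hrχ⟩, -⟩, P, rfl⟩ := hD
  refine ⟨n, fun hn => hr ?_, Subgroup.map_subtype_le _, P.toSubgroup.index,
    P.not_dvd_index, ?_⟩
  · rw [← coe_mem_coeIdeal, hrχ]
    have h1 := bl_eq_iff.mp (hχ.trans hθ.symm) n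
    simpa using add_mem h1 hn
  · rw [← P.toSubgroup.card_mul_index, Nat.card_congr (P.toSubgroup.equivMapOfInjective _
      (Subgroup.subtype_injective _)).toEquiv]

theorem natCast_notMem_coeIdeal [hM : M.IsPrime] [hp : Fact p.Prime] (hpM : (p : AlgInt) ∈ M)
    {j : ℕ} (hj : ¬ p ∣ j) : (j : ℂ) ∉ coeIdeal M := by
  have := charP_quotient hpM
  intro h
  apply hj
  rw [← CharP.cast_eq_zero_iff (AlgInt ⧸ M) p j]
  have h1 : ((j : AlgInt) : ℂ) ∈ coeIdeal M := by simpa using h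
  have := Ideal.Quotient.eq_zero_iff_mem.mpr (coe_mem_coeIdeal.mp h1)
  simpa using this

/-- For `n` in a defect class with `|C_N(n)| = |D| j`, counting gives `j ω_θ(n) = φ(n) r`, where `r`
is the ratio, by way of `card_mul_card`. The left side is outside `M`, and `φ(n)` is integral
because `n` centralises `D`. -/
theorem IsCentralizerCharacter.card_div_notMem [Fintype G] [hM : M.IsPrime] [hp : Fact p.Prime]
    (hpM : (p : AlgInt) ∈ M) (hdef : IsDefectGroup p b D) (hθ : bl M θ = b)
    (hD : IsCentralFactor N (D.map N.subtype)) (h : ∀ n : N, θ' (n : G) = θ n)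
    (hφ : IsCentralizerCharacter N (D.map N.subtype) θ' φ) :
    (Nat.card ↥(N ⊓ Subgroup.centralizer (D.map N.subtype : Set G)) : ℂ) /
      (Nat.card ↥(D.map N.subtype ⊓ Subgroup.centralizer (D.map N.subtype : Set G)) * φ 1) ∉
        coeIdeal M := by
  obtain ⟨n, hn, hle, j, hj, hcard⟩ := hdef.exists_centralChar hθ
  have hjint : IsIntegral ℤ (j : ℂ) := by
    exact_mod_cast isIntegral_algebraMap (R := ℤ) (A := ℂ) (x := j)
  have hcl := card_conjugatesOf_mul_card_centralizer n
  have hDD : Nat.card (D.map N.subtype) = Nat.card D :=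
    Nat.card_congr (D.equivMapOfInjective _ N.subtype_injective).symm.toEquiv
  have hprod := hD.card_mul_card
  have hnC : (n : G) ∈ Subgroup.centralizer (D.map N.subtype : Set G) := by
    rw [Subgroup.mem_centralizer_iff]
    rintro _ ⟨d, hd, rfl⟩
    have := Subgroup.mem_centralizer_iff.mp (hle hd) n rfl
    exact (congrArg Subtype.val this).symm
  rw [hDD] at hprod
  rw [hcard] at hcl
  intro hr
  have h1 : (j : ℂ) * centralChar θ n ∈ coeIdeal M := by
    have h2 : (j : ℂ) * centralChar θ n =
        φ n * ((Nat.card ↥(N ⊓ Subgroup.centralizer (D.map N.subtype : Set G)) : ℂ) /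
      (Nat.card ↥(D.map N.subtype ⊓ Subgroup.centralizer (D.map N.subtype : Set G)) * φ 1)) := by
      have h3 : (Nat.card ↥(D.map N.subtype ⊓
          Subgroup.centralizer (D.map N.subtype : Set G)) : ℂ) ≠ 0 :=
        Nat.cast_ne_zero.mpr Nat.card_pos.ne'
      have h4 : (Nat.card D : ℂ) ≠ 0 := Nat.cast_ne_zero.mpr Nat.card_pos.ne'
      have h5 := hφ.one_ne_zero
      have h6 := θ'.one_ne_zero
      have h7 : θ 1 = θ' 1 := (h 1).symm
      rw [centralChar, ← h n, h7, mul_div_assoc, ← hφ.div_one_eq]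
      have h8 : (Nat.card N : ℂ) * Nat.card ↥(D.map N.subtype ⊓
          Subgroup.centralizer (D.map N.subtype : Set G)) =
        Nat.card ↥(N ⊓ Subgroup.centralizer (D.map N.subtype : Set G)) * Nat.card D := by
        exact_mod_cast hprod
      have h9 : (Nat.card (conjugatesOf n) : ℂ) * (Nat.card D * j) = Nat.card N := by
        exact_mod_cast hcl
      field_simp
      apply mul_right_cancel₀ h4
      linear_combination φ n * h8 + φ n * Nat.card ↥(D.map N.subtype ⊓
          Subgroup.centralizer (D.map N.subtype : Set G)) * h9
    rw [h2]
    exact mul_mem_coeIdeal (hφ.isIntegral n hnC) hr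
  rcases mem_or_mem_of_mul_mem_coeIdeal hjint (isIntegral_centralChar θ n) h1 with h2 | h2
  · exact natCast_notMem_coeIdeal hpM hj h2
  · exact hn h2

end DefectGroup

/-! ### Group ring elements with coefficients in `M`. -/

section CoefficientIdeal

variable {G : Type*} [Group G] [Fintype G] {M : Ideal AlgInt} {x : MonoidAlgebra AlgInt G}

theorem coeff_mul_mem_of_right (y : MonoidAlgebra AlgInt G) (hx : ∀ g, x.coeff g ∈ M) (g : G) :
    (y * x).coeff g ∈ M := by
  rw [coeff_mul_sum_left]
  exact sum_mem fun h _ => M.mul_mem_left _ (hx _)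

theorem coeff_pow_mem_of_pos (hx : ∀ g, x.coeff g ∈ M) {n : ℕ} (hn : 0 < n) (g : G) :
    (x ^ n).coeff g ∈ M := by
  obtain ⟨k, rfl⟩ := Nat.exists_eq_succ_of_ne_zero hn.ne'
  rw [pow_succ]
  exact coeff_mul_mem_of_right _ hx g

end CoefficientIdeal

/-! ### Central elements supported on `N` and constituents of restrictions. -/

section Restriction

variable {G : Type*} [Group G] [Fintype G] {N : Subgroup G} {M : Ideal AlgInt}

theorem sum_coeff_mul_character {V : Type*} [AddCommGroup V] [Module ℂ V] [FiniteDimensional ℂ V]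
    (ρ : Representation ℂ G V) {z : MonoidAlgebra AlgInt G} {s : ℂ}
    (h : intAction ρ z = s • 1) (y : G) :
    ∑ g, (z.coeff g : ℂ) * ρ.character (y * g) = s * ρ.character y := by
  have h1 := congrArg (fun X => LinearMap.trace ℂ V (ρ y * X)) h
  simp only [intAction_apply, Finset.mul_sum, mul_smul_comm, mul_one, map_sum, map_smul,
    ← map_mul, smul_eq_mul] at h1
  exact h1

theorem Irr.sum_coeff_mul (χ : Irr G) {z : MonoidAlgebra AlgInt G}
    (hz : z ∈ Subalgebra.center AlgInt (MonoidAlgebra AlgInt G)) (y : G) :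
    ∑ g, (z.coeff g : ℂ) * χ (y * g) = omega χ z * χ y := by
  obtain ⟨χ, n, ρ, hρ, rfl⟩ := χ
  exact sum_coeff_mul_character ρ (intAction_of_mem_center ρ hz) y

theorem Irr.sum_coeff_mul_of_conj_invariant {θ : Irr N} {θ' : Irr G}
    (h : ∀ n : N, θ' (n : G) = θ n) {z : MonoidAlgebra AlgInt G}
    (hz : ∀ n ∈ N, ∀ x, z.coeff (n * x * n⁻¹) = z.coeff x) (y : G) :
    ∑ g, (z.coeff g : ℂ) * θ' (y * g) = omega θ' z * θ' y := by
  obtain ⟨χ, n, ρ, hρ, rfl⟩ := θ'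
  have := isIrreducible_restrict ρ θ h
  exact sum_coeff_mul_character ρ (intAction_of_conj_invariant (N := N) ρ hz) y

/-- The restriction of coefficients of an element of the group ring to a subgroup. -/
noncomputable def restrictCoeff (N : Subgroup G) (z : MonoidAlgebra AlgInt G) :
    MonoidAlgebra AlgInt N :=
  ofFun fun n => z.coeff (n : G)

theorem restrictCoeff_mem_center {z : MonoidAlgebra AlgInt G}
    (hz : z ∈ Subalgebra.center AlgInt (MonoidAlgebra AlgInt G)) :
    restrictCoeff N z ∈ Subalgebra.center AlgInt (MonoidAlgebra AlgInt N) :=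
  (mem_center_iff_coeff_conj _).mpr fun x n => (mem_center_iff_coeff_conj z).mp hz x n

theorem sum_coeff_eq_sum_restrictCoeff {z : MonoidAlgebra AlgInt G} (hN : ∀ x ∉ N, z.coeff x = 0)
    (F : G → ℂ) :
    ∑ x, (z.coeff x : ℂ) * F x = ∑ n : N, ((restrictCoeff N z).coeff n : ℂ) * F n := by
  symm
  refine Finset.sum_of_injOn (fun n : N => (n : G)) ?_ ?_ ?_ ?_
  · exact fun _ _ _ _ h => Subtype.ext h
  · exact fun _ _ => Finset.mem_coe.mpr (Finset.mem_univ _)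
  · intro x _ hx
    have : x ∉ N := fun h => hx ⟨⟨x, h⟩, by simp, rfl⟩
    rw [hN x this]
    simp
  · exact fun n _ => rfl

theorem omega_eq_omega_restrictCoeff {θ : Irr N} {θ' : Irr G} (h : ∀ n : N, θ' (n : G) = θ n)
    {z : MonoidAlgebra AlgInt G} (hN : ∀ x ∉ N, z.coeff x = 0) :
    omega θ (restrictCoeff N z) = omega θ' z := by
  have h1 : θ' 1 = θ 1 := h 1
  rw [omega, omega, sum_coeff_eq_sum_restrictCoeff hN, h1]
  simp only [h]

/-- Central elements supported on `N` have the same central character values at `χ` and at a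
constituent of the restriction of `χ` to `N`. -/
theorem omega_restrictCoeff_of_resInner_ne_zero {χ : Irr G} {ψ : Irr N}
    (hψ : resInner χ ψ ≠ 0) {z : MonoidAlgebra AlgInt G}
    (hz : z ∈ Subalgebra.center AlgInt (MonoidAlgebra AlgInt G)) (hN : ∀ x ∉ N, z.coeff x = 0) :
    omega χ z = omega ψ (restrictCoeff N z) := by
  have hS : ∑ m : N, χ (m : G) * ψ m⁻¹ ≠ 0 := by
    intro h
    apply hψ
    rw [resInner, finsum_eq_sum_of_fintype, h, mul_zero]
  -- After multiplication by the inner product both sides are the same double sum over `N`, up to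
  -- the substitution `m ↦ m * n`.
  apply mul_right_cancel₀ hS
  have h1 : ∀ m : N, omega χ z * (χ (m : G) * ψ m⁻¹) =
      ∑ n : N, ((restrictCoeff N z).coeff n : ℂ) * χ ((m : G) * n) * ψ m⁻¹ := by
    intro m
    rw [← mul_assoc, ← χ.sum_coeff_mul hz (m : G), sum_coeff_eq_sum_restrictCoeff hN,
      Finset.sum_mul]
  have h2 : ∀ m : N, omega ψ (restrictCoeff N z) * (χ (m : G) * ψ m⁻¹) =
      ∑ n : N, ((restrictCoeff N z).coeff n : ℂ) * χ (m : G) * ψ (n * m⁻¹) := by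
    intro m
    rw [mul_left_comm, ← ψ.sum_coeff_mul (restrictCoeff_mem_center hz) m⁻¹, Finset.mul_sum]
    refine Finset.sum_congr rfl fun n _ => ?_
    rw [ψ.mul_comm]
    ring
  rw [Finset.mul_sum, Finset.mul_sum, Finset.sum_congr rfl fun m _ => h1 m,
    Finset.sum_congr rfl fun m _ => h2 m]
  refine (Finset.sum_comm.trans (Finset.sum_congr rfl fun n _ => ?_)).trans Finset.sum_comm
  refine Fintype.sum_equiv (Equiv.mulRight n) _ _ fun m => ?_
  simp only [Equiv.coe_mulRight, Subgroup.coe_mul, mul_inv_rev, mul_inv_cancel_left]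

end Restriction

theorem conj_pow_eq_iff {G : Type*} [Group G] (g x : G) (n : ℕ) :
    (g * x * g⁻¹) ^ n = g * x * g⁻¹ ↔ x ^ n = x := by
  rw [conj_pow, mul_left_inj, mul_right_inj]

/-! ### Injectivity of `υ`. -/

section Injectivity

variable {G : Type*} [Group G] [Fintype G] {N D : Subgroup G} {θ : Irr N} {θ' : Irr G}
  {φ : G → ℂ} {M : Ideal AlgInt} {p E : ℕ}

theorem IsCentralizerCharacter.omega_cosetPart_eq (hφ : IsCentralizerCharacter N D θ' φ)
    {X : G → Prop} {w : MonoidAlgebra AlgInt G}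
    (hw : ∀ x, (w.coeff x : ℂ) = if X x then φ x⁻¹ else 0) (q : G ⧸ N) :
    omega θ' (cosetPart N w q) =
      (∑ x with (QuotientGroup.mk x : G ⧸ N) = q ∧ X x, φ x⁻¹ * φ x) / φ 1 := by
  have h1 := hφ.omega_eq (X := fun x => (QuotientGroup.mk x : G ⧸ N) = q ∧ X x)
    (w := cosetPart N w q) fun x => ?_
  · convert h1
  rw [coeff_cosetPart]
  by_cases h : (QuotientGroup.mk x : G ⧸ N) = q
  · simp only [h, if_true, true_and, hw]
  · simp only [h, if_false, false_and]
    rfl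

theorem IsCentralizerCharacter.mem_center (hφ : IsCentralizerCharacter N D θ' φ)
    {X : G → Prop} {w : MonoidAlgebra AlgInt G}
    (hw : ∀ x, (w.coeff x : ℂ) = if X x then φ x⁻¹ else 0)
    (hX : ∀ g x, X (g * x * g⁻¹) ↔ X x) :
    w ∈ Subalgebra.center AlgInt (MonoidAlgebra AlgInt G) := by
  rw [mem_center_iff_coeff_conj]
  intro g x
  apply Subtype.ext
  have h1 : (g * x * g⁻¹)⁻¹ = g * x⁻¹ * g⁻¹ := by group
  rw [hw, hw, h1, hφ.conj]
  simp only [hX]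

theorem IsCentralizerCharacter.bl_eq_of_bl_mul_eq [N.Normal] (hφ : IsCentralizerCharacter N D θ' φ)
    [hM : M.IsPrime] [Fact p.Prime] (hpM : (p : AlgInt) ∈ M) (hE : IsRegularExponent p E G)
    (hD : IsCentralFactor N D) (hDp : IsPGroup p D) (h : ∀ n : N, θ' (n : G) = θ n)
    (hr : (Nat.card ↥(N ⊓ Subgroup.centralizer (D : Set G)) : ℂ) /
        (Nat.card ↥(D ⊓ Subgroup.centralizer (D : Set G)) * φ 1) ∉ coeIdeal M)
    {η₁ η₂ : Irr (G ⧸ N)} {χ₁ χ₂ : Irr G}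
    (h₁ : ∀ g : G, χ₁ g = θ' g * η₁ (QuotientGroup.mk g))
    (h₂ : ∀ g : G, χ₂ g = θ' g * η₂ (QuotientGroup.mk g)) (hχ : bl M χ₁ = bl M χ₂) :
    bl M η₁ = bl M η₂ := by
  refine bl_eq_of_regular hpM (hE.quotient N) fun q hq => ?_
  obtain ⟨X, hX⟩ : ∃ X : G → Prop, ∀ x, X x ↔
      x ^ E = x ∧ IsConj q (QuotientGroup.mk x : G ⧸ N) := ⟨_, fun _ => Iff.rfl⟩
  obtain ⟨w, hw⟩ := hφ.exists_coeff_eq X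
    (fun x hx => hE.mem_centralizer_of_pow_eq hD hDp ((hX x).mp hx).1)
  have hwc := hφ.mem_center hw fun g x => by
    rw [hX, hX, conj_pow_eq_iff]
    refine and_congr_right fun _ => ⟨fun hc => hc.trans ?_, fun hc => hc.trans ?_⟩
    · exact (isConj_iff.mpr ⟨QuotientGroup.mk g, rfl⟩ :
        IsConj (QuotientGroup.mk x : G ⧸ N) (QuotientGroup.mk (g * x * g⁻¹))).symm
    · exact isConj_iff.mpr ⟨QuotientGroup.mk g, rfl⟩
  have hri := hφ.isIntegral_card_div hD h
  set r : ℂ := (Nat.card ↥(N ⊓ Subgroup.centralizer (D : Set G)) : ℂ) /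
        (Nat.card ↥(D ⊓ Subgroup.centralizer (D : Set G)) * φ 1) with hrdef
  -- On conjugates of `q` this is `sum_regular_sub_mem`; the other cosets contain no element of `X`.
  have hsub : ∀ y, (quotientHom N θ' w - (⟨r, hri⟩ : AlgInt) • classSum q).coeff y ∈ M := by
    intro y
    rw [← coe_mem_coeIdeal]
    have h3 : ((quotientHom N θ' w - (⟨r, hri⟩ : AlgInt) • classSum q).coeff y : ℂ) =
        omega θ' (cosetPart N w y) - r * if IsConj q y then 1 else 0 := by
      rw [← coeff_quotientHom h hwc]
      simp only [MonoidAlgebra.coeff_sub, MonoidAlgebra.coeff_smul, Finsupp.sub_apply,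
        Finsupp.smul_apply, classSum, coeff_ofFun]
      push_cast
      split_ifs <;> simp
    rw [h3, hφ.omega_cosetPart_eq hw y]
    by_cases hy : IsConj q y
    · rw [if_pos hy, mul_one]
      have hyE : y ^ E = y := by
        obtain ⟨c, rfl⟩ := isConj_iff.mp hy
        rw [conj_pow, hq]
      have h4 := hφ.sum_regular_sub_mem hpM hE hD hDp h hr hyE
      convert h4 using 3
      refine Finset.sum_congr (Finset.ext fun x => ?_) fun _ _ => rfl
      rw [Finset.mem_filter, Finset.mem_filter]
      refine and_congr_right fun _ => and_congr_right fun hx => ?_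
      rw [hX, hx]
      exact and_iff_left hy
    · rw [if_neg hy, mul_zero, sub_zero, Finset.filter_false_of_mem, Finset.sum_empty, zero_div]
      · exact Submodule.zero_mem _
      · rintro x - ⟨rfl, hx⟩
        exact hy ((hX x).mp hx).2
  have hom : ∀ η : Irr (G ⧸ N), omega η (quotientHom N θ' w) - r * centralChar η q ∈
      coeIdeal M := by
    intro η
    have h3 := omega_mem_coeIdeal η (sub_mem (quotientHom_mem_center h hwc)
      (Subalgebra.smul_mem _ (classSum_mem_center q) _)) hsub
    rwa [omega_sub, omega_smul, omega_classSum] at h3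
  have h3 := omega_sub_mem_of_bl_eq hχ hwc
  rw [omega_mul_eq_omega_quotientHom h hwc η₁ χ₁ h₁,
    omega_mul_eq_omega_quotientHom h hwc η₂ χ₂ h₂] at h3
  have h4 : r * (centralChar η₁ q - centralChar η₂ q) ∈ coeIdeal M := by
    convert add_mem (sub_mem h3 (hom η₁)) (hom η₂) using 1
    ring
  exact (mem_or_mem_of_mul_mem_coeIdeal hri ((isIntegral_centralChar η₁ q).sub
    (isIntegral_centralChar η₂ q)) h4).resolve_left hr

end Injectivity

/-! ### Separating `χ` from the blocks in the image. -/

section Separation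

variable {G : Type*} [Group G] [Fintype G] {N D : Subgroup G} {θ : Irr N} {θ' : Irr G}
  {φ : G → ℂ} {M : Ideal AlgInt} {p E : ℕ}

/-- Finitely many irreducible characters outside the block of `χ` are separated from `χ` by a
central element of the group ring. -/
theorem exists_center_separating [M.IsPrime] {ι : Type*} (f : ι → Irr G) (χ : Irr G)
    (hf : ∀ i, bl M (f i) ≠ bl M χ) (s : Finset ι) :
    ∃ z ∈ Subalgebra.center AlgInt (MonoidAlgebra AlgInt G),
      (∀ i ∈ s, omega (f i) z ∈ coeIdeal M) ∧ omega χ z ∉ coeIdeal M := by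
  induction s using Finset.induction_on with
  | empty =>
    refine ⟨1, one_mem _, by simp, ?_⟩
    rw [omega_one]
    intro h
    have h1 : ((1 : AlgInt) : ℂ) ∈ coeIdeal M := h
    exact (Ideal.ne_top_iff_one M).mp (Ideal.IsPrime.ne_top ‹_›) (coe_mem_coeIdeal.mp h1)
  | insert i s _ ih =>
    obtain ⟨z, hz, hzs, hzχ⟩ := ih
    have h1 : ∃ g, centralChar (f i) g - centralChar χ g ∉ coeIdeal M := by
      by_contra! h1
      exact hf i (bl_eq_iff.mpr h1)
    obtain ⟨g, hg⟩ := h1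
    -- The new factor `classSum g - c • 1` vanishes at `f i` and is nonzero modulo `M` at `χ`.
    let c : AlgInt := ⟨centralChar (f i) g, isIntegral_centralChar (f i) g⟩
    have hw : classSum g - c • (1 : MonoidAlgebra AlgInt G) ∈
        Subalgebra.center AlgInt (MonoidAlgebra AlgInt G) :=
      sub_mem (classSum_mem_center g) (Subalgebra.smul_mem _ (one_mem _) c)
    have hom : ∀ ψ : Irr G, omega ψ (classSum g - c • 1) =
        centralChar ψ g - centralChar (f i) g := by
      intro ψ
      rw [omega_sub, omega_classSum, omega_smul, omega_one, mul_one]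
    refine ⟨z * (classSum g - c • 1), mul_mem hz hw, ?_, ?_⟩
    · intro j hj
      rw [omega_mul _ hz hw]
      rcases Finset.mem_insert.mp hj with rfl | hj
      · rw [hom, sub_self, mul_zero]
        exact Submodule.zero_mem _
      · rw [mul_comm]
        exact mul_mem_coeIdeal (isIntegral_omega _ hw) (hzs j hj)
    · rw [omega_mul _ hz hw]
      intro h
      rcases mem_or_mem_of_mul_mem_coeIdeal (isIntegral_omega _ hz) (isIntegral_omega _ hw) h
        with h2 | h2
      · exact hzχ h2
      · apply hg
        rw [hom] at h2
        rwa [← neg_mem_iff, neg_sub]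

theorem omega_cosetPart_mem_of_coeff_sub_mem [N.Normal] [M.IsPrime]
    (h : ∀ n : N, θ' (n : G) = θ n) {z a : MonoidAlgebra AlgInt G}
    (hz : z ∈ Subalgebra.center AlgInt (MonoidAlgebra AlgInt G))
    (ha : a ∈ Subalgebra.center AlgInt (MonoidAlgebra AlgInt G))
    (hza : ∀ x, (z - a).coeff x ∈ M) {q : G ⧸ N}
    (hq : omega θ' (cosetPart N z q) ∈ coeIdeal M) : omega θ' (cosetPart N a q) ∈ coeIdeal M := by
  have h1 : cosetPart N (z - a) q = cosetPart N z q - cosetPart N a q := by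
    refine MonoidAlgebra.coeff_injective (Finsupp.ext fun x => ?_)
    rw [MonoidAlgebra.coeff_sub, Finsupp.sub_apply, coeff_cosetPart, coeff_cosetPart,
      coeff_cosetPart, MonoidAlgebra.coeff_sub, Finsupp.sub_apply]
    split_ifs <;> simp
  have h2 : omega θ' (cosetPart N (z - a) q) ∈ coeIdeal M := by
    rw [← coeff_quotientHom h (sub_mem hz ha)]
    exact coe_mem_coeIdeal.mpr (coeff_quotientHom_mem h (sub_mem hz ha) hza q)
  rw [h1, omega_sub] at h2
  simpa using sub_mem hq h2

/-- If a central `y` is zero modulo `M` at all `f η`, its image under `quotientHom` is nilpotent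
modulo `M`. A power of `y` then has image zero, a further `E`-th power is supported on regular
elements modulo `M`, and truncating to these gives `a`. -/
theorem exists_regular_center_separating [N.Normal] [M.IsPrime] [hp : Fact p.Prime]
    (hpM : (p : AlgInt) ∈ M) (hE : IsRegularExponent p E G) (h : ∀ n : N, θ' (n : G) = θ n)
    {f : Irr (G ⧸ N) → Irr G} (hf : ∀ η, ∀ g : G, f η g = θ' g * η (QuotientGroup.mk g))
    (χ : Irr G) (hχ : ∀ η, bl M (f η) ≠ bl M χ) :
    ∃ a ∈ Subalgebra.center AlgInt (MonoidAlgebra AlgInt G),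
      (∀ x, x ^ E ≠ x → a.coeff x = 0) ∧
      (∀ q : G ⧸ N, omega θ' (cosetPart N a q) ∈ coeIdeal M) ∧ omega χ a ∉ coeIdeal M := by
  have := finite_irr (G ⧸ N)
  have := Fintype.ofFinite (Irr (G ⧸ N))
  have hE0 : 0 < E := by
    obtain ⟨k, -, hk⟩ := hE.exists_eq_pow
    rw [hk]
    exact pow_pos hp.out.pos k
  obtain ⟨y, hy, hyf, hyχ⟩ := exists_center_separating f χ hχ Finset.univ
  obtain ⟨m, hm⟩ := exists_pow_coeff_mem (quotientHom N θ' y) (quotientHom_mem_center h hy)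
    fun η => by
      rw [← omega_mul_eq_omega_quotientHom h hy η (f η) (hf η)]
      exact hyf η (Finset.mem_univ η)
  -- `m` may be `0`, while `quotientHom_pow` takes positive exponents.
  have hm1 : ∀ q, (quotientHom N θ' y ^ (m + 1)).coeff q ∈ M := fun q => by
    rw [pow_succ']
    exact coeff_mul_mem_of_right _ hm q
  have hwc := pow_mem hy (m + 1)
  have hzc := pow_mem hwc E
  set z := (y ^ (m + 1)) ^ E with hz
  have hzq : ∀ q : G ⧸ N, omega θ' (cosetPart N z q) ∈ coeIdeal M := by
    intro q
    rw [← coeff_quotientHom h hzc, coe_mem_coeIdeal, hz, quotientHom_pow h hwc E hE0,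
      quotientHom_pow h hy (m + 1) m.succ_pos]
    exact coeff_pow_mem_of_pos hm1 hE0 q
  have hzχ : omega χ z ∉ coeIdeal M := by
    rw [hz, ← pow_mul, omega_pow χ hy]
    exact fun h1 => hyχ (mem_of_pow_mem_coeIdeal (isIntegral_omega χ hy) h1)
  let a : MonoidAlgebra AlgInt G := ofFun fun x => if x ^ E = x then z.coeff x else 0
  have hac : a ∈ Subalgebra.center AlgInt (MonoidAlgebra AlgInt G) := by
    rw [mem_center_iff_coeff_conj]
    intro g x
    simp only [a, coeff_ofFun, conj_pow_eq_iff, (mem_center_iff_coeff_conj z).mp hzc]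
  have hza : ∀ x, (z - a).coeff x ∈ M := by
    intro x
    rw [MonoidAlgebra.coeff_sub, Finsupp.sub_apply]
    simp only [a, coeff_ofFun]
    split_ifs with hx
    · rw [sub_self]
      exact M.zero_mem
    · rw [sub_zero]
      exact coeff_pow_mem hpM hE hwc x hx
  refine ⟨a, hac, fun x hx => ?_, fun q => ?_, fun h1 => hzχ ?_⟩
  · simp only [a, coeff_ofFun, if_neg hx]
  · exact omega_cosetPart_mem_of_coeff_sub_mem h hzc hac hza (hzq q)
  · have h2 := omega_mem_coeIdeal χ (sub_mem hzc hac) hza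
    rw [omega_sub] at h2
    simpa using add_mem h2 h1

end Separation

/-! ### Surjectivity of `υ`. -/

section Surjectivity

variable {G : Type*} [Group G] [Fintype G] {N D : Subgroup G} {θ : Irr N} {θ' : Irr G}
  {φ : G → ℂ} {M : Ideal AlgInt} {p E : ℕ}

/-- The sum of the elements of a subgroup. -/
noncomputable def subgroupSum (Z : Subgroup G) : MonoidAlgebra AlgInt G :=
  ofFun fun x => if x ∈ Z then 1 else 0

theorem coeff_mul_subgroupSum (Z : Subgroup G) (w : MonoidAlgebra AlgInt G) (y : G) :
    (w * subgroupSum Z).coeff y = ∑ x with x⁻¹ * y ∈ Z, w.coeff x := by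
  rw [coeff_mul_sum_left, Finset.sum_filter]
  refine Finset.sum_congr rfl fun x _ => ?_
  simp only [subgroupSum, coeff_ofFun, mul_ite, mul_one, mul_zero]

/-- If `w` is supported modulo `M` on regular elements and `w Z⁺` vanishes modulo `M`, then so
does `w`. -/
theorem coeff_mem_of_mul_subgroupSum (hE : IsRegularExponent p E G) (hD : IsCentralFactor N D)
    (hDp : IsPGroup p D) {w : MonoidAlgebra AlgInt G} (hw : ∀ x, x ^ E ≠ x → w.coeff x ∈ M)
    (h : ∀ x, (w * subgroupSum (D ⊓ Subgroup.centralizer (D : Set G))).coeff x ∈ M) (y : G) :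
    w.coeff y ∈ M := by
  by_cases hy : y ^ E = y
  · have h1 := h y
    rw [coeff_mul_subgroupSum, ← Finset.add_sum_erase _ _ (a := y) (by simp)] at h1
    -- The other elements of the coset of `y` also have `E`-th power `y`, so none of them is
    -- regular.
    refine (Submodule.add_mem_iff_left _ (sum_mem fun x hx => ?_)).mp h1
    obtain ⟨hxy, hx⟩ := Finset.mem_erase.mp hx
    refine hw x fun hxE => hxy ?_
    have h2 := hE.pow_mul_of_mem_center hD hDp (Finset.mem_filter.mp hx).2 x
    rw [mul_inv_cancel_left, hxE, hy] at h2
    exact h2.symm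
  · exact hw y hy

namespace IsCentralizerCharacter

variable (hφ : IsCentralizerCharacter N D θ' φ)

include hφ

/-- For `y ∈ C_G(D)` the coefficient is `φ(y⁻¹)` times `ω_θ'` of the part of `a` in the coset of
`y`, as that part acts on `θ'` by a scalar. Elsewhere it vanishes, since `a` and `F` are supported
on `C_G(D)`. -/
theorem coeff_mul_mem_of_omega_cosetPart_mem [N.Normal]
    (h : ∀ n : N, θ' (n : G) = θ n) {a F : MonoidAlgebra AlgInt G}
    (hac : a ∈ Subalgebra.center AlgInt (MonoidAlgebra AlgInt G))
    (haC : ∀ x ∉ Subgroup.centralizer (D : Set G), a.coeff x = 0)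
    (ha : ∀ q : G ⧸ N, omega θ' (cosetPart N a q) ∈ coeIdeal M)
    (hF : ∀ x, (F.coeff x : ℂ) =
      if x ∈ N ⊓ Subgroup.centralizer (D : Set G) then φ x⁻¹ else 0) (y : G) :
    (a * F).coeff y ∈ M := by
  rw [← coe_mem_coeIdeal, coeff_mul_sum_left]
  push_cast
  by_cases hy : y ∈ Subgroup.centralizer (D : Set G)
  · have h1 := Irr.sum_coeff_mul_of_conj_invariant h (cosetPart_conj_invariant
      (conj_invariant_of_mem_center hac) (QuotientGroup.mk y : G ⧸ N)) y⁻¹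
    have h2 : ∑ x, (a.coeff x : ℂ) * (F.coeff (x⁻¹ * y) : ℂ) =
        φ y⁻¹ * omega θ' (cosetPart N a (QuotientGroup.mk y : G ⧸ N)) := by
      rw [hφ.eq_mul y⁻¹, mul_assoc, _root_.mul_comm (θ' _), ← h1, Finset.mul_sum]
      refine Finset.sum_congr rfl fun x _ => ?_
      rw [hF, coeff_cosetPart]
      by_cases hx : x ∈ Subgroup.centralizer (D : Set G)
      · have h3 : x⁻¹ * y ∈ N ⊓ Subgroup.centralizer (D : Set G) ↔
            (QuotientGroup.mk x : G ⧸ N) = QuotientGroup.mk y := by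
          rw [QuotientGroup.eq, Subgroup.mem_inf]
          exact and_iff_left (mul_mem (inv_mem hx) hy)
        simp only [h3]
        split_ifs
        · rw [hφ.eq_mul, mul_inv_rev, inv_inv]
          ring
        · simp
      · rw [haC x hx]
        split_ifs <;> simp
    rw [h2]
    exact mul_mem_coeIdeal (hφ.isIntegral _ (inv_mem hy)) (ha _)
  · rw [Finset.sum_eq_zero]
    · exact Submodule.zero_mem _
    · intro x _
      by_cases hx : x ∈ Subgroup.centralizer (D : Set G)
      · rw [hF, if_neg, mul_zero]
        intro h3
        apply hy
        have h4 := mul_mem hx h3.2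
        rwa [mul_inv_cancel_left] at h4
      · rw [haC x hx]
        simp

/-- If the `p`-part of `x` lies in `D ∩ C_G(D)`, only `x ^ E` can contribute to the product, and
passing from `φ` at `(x ^ E)⁻¹` to `φ` at `x⁻¹` costs a central value congruent to `1`. For other
`x` the product has coefficient zero, and that of `F` is in `M` by `mem_coeIdeal_of_notMem`. -/
theorem coeff_mul_subgroupSum_sub_mem [N.Normal] [M.IsPrime] [Fact p.Prime]
    (hpM : (p : AlgInt) ∈ M) (hE : IsRegularExponent p E G) (hD : IsCentralFactor N D)
    (hDp : IsPGroup p D) (h : ∀ n : N, θ' (n : G) = θ n)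
    (hr : (Nat.card ↥(N ⊓ Subgroup.centralizer (D : Set G)) : ℂ) /
        (Nat.card ↥(D ⊓ Subgroup.centralizer (D : Set G)) * φ 1) ∉ coeIdeal M)
    {f F : MonoidAlgebra AlgInt G}
    (hf : ∀ x, (f.coeff x : ℂ) = if x ∈ N ∧ x ^ E = x then φ x⁻¹ else 0)
    (hF : ∀ x, (F.coeff x : ℂ) =
      if x ∈ N ⊓ Subgroup.centralizer (D : Set G) then φ x⁻¹ else 0) (x : G) :
    (f * subgroupSum (D ⊓ Subgroup.centralizer (D : Set G)) - F).coeff x ∈ M := by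
  rw [← coe_mem_coeIdeal, MonoidAlgebra.coeff_sub, Finsupp.sub_apply, coeff_mul_subgroupSum]
  push_cast
  rw [hF]
  have h1 : ∀ y, y⁻¹ * x ∈ D ⊓ Subgroup.centralizer (D : Set G) → y ^ E = y → y = x ^ E := by
    intro y hy hyE
    have h2 := hE.pow_mul_of_mem_center hD hDp hy y
    rw [mul_inv_cancel_left, hyE] at h2
    exact h2.symm
  by_cases hx : (x ^ E)⁻¹ * x ∈ D ⊓ Subgroup.centralizer (D : Set G)
  · rw [Finset.sum_eq_single (x ^ E)]
    · have hxC : x ^ E ∈ Subgroup.centralizer (D : Set G) :=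
        hE.mem_centralizer_of_pow_eq hD hDp (hE.pow_pow x)
      have h3 : x ∈ N ⊓ Subgroup.centralizer (D : Set G) ↔ x ^ E ∈ N := by
        rw [← mul_inv_cancel_left (x ^ E) x, Subgroup.mem_inf,
          N.mul_mem_cancel_right (hD.le hx.1), mul_inv_cancel_left]
        refine and_iff_left ?_
        have h4 := mul_mem hxC hx.2
        rwa [mul_inv_cancel_left] at h4
      rw [hf]
      simp only [h3, hE.pow_pow, and_true]
      split_ifs
      · have h4 := hφ.apply_mul_of_mem_center hD (inv_mem hx) (x ^ E)⁻¹
        have h5 : (x ^ E)⁻¹ * ((x ^ E)⁻¹ * x)⁻¹ = x⁻¹ := by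
          have := (((Commute.refl x).pow_left E).inv_left).inv_right
          rw [mul_inv_rev, inv_inv, ← mul_assoc, this.eq, inv_mul_cancel_right]
        rw [h5] at h4
        rw [h4, ← neg_mem_iff]
        convert mul_mem_coeIdeal (hφ.isIntegral _ (inv_mem hxC))
          (centralValue_sub_one_mem hpM hE hD hDp θ' (inv_mem hx)).2 using 1
        ring
      · rw [sub_zero]
        exact Submodule.zero_mem _
    · intro y hy hyx
      rw [hf, if_neg]
      exact fun h3 => hyx (h1 y (Finset.mem_filter.mp hy).2 h3.2)
    · intro h3
      exact absurd (Finset.mem_filter.mpr ⟨Finset.mem_univ (x ^ E), hx⟩) h3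
  · rw [Finset.sum_eq_zero, zero_sub, neg_mem_iff]
    · split_ifs with hxC
      · have hcomm := ((Commute.refl x).pow_left E).inv_right
        have h4 : (x⁻¹ ^ E)⁻¹ * x⁻¹ = ((x ^ E)⁻¹ * x)⁻¹ := by
          rw [inv_pow, inv_inv, mul_inv_rev, inv_inv]
          exact hcomm.eq
        have h5 : (x ^ E)⁻¹ * x ∈ Subgroup.centralizer (D : Set G) :=
          mul_mem (inv_mem (pow_mem hxC.2 E)) hxC.2
        refine hφ.mem_coeIdeal_of_notMem hpM hE hD h hr (inv_mem hxC.2) ?_ ?_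
        · rw [h4, inv_mem_iff]
          exact mul_mem (inv_mem (pow_mem hxC.1 E)) hxC.1
        · rw [h4, inv_mem_iff]
          exact fun h6 => hx ⟨h6, h5⟩
      · exact Submodule.zero_mem _
    · intro y hy
      rw [hf, if_neg]
      intro h3
      have h4 := h1 y (Finset.mem_filter.mp hy).2 h3.2
      exact hx (h4 ▸ (Finset.mem_filter.mp hy).2)

theorem exists_bl_mul_eq [N.Normal] [hM : M.IsPrime] [hp : Fact p.Prime]
    (hpM : (p : AlgInt) ∈ M) (hE : IsRegularExponent p E G) (hD : IsCentralFactor N D)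
    (hDp : IsPGroup p D) (h : ∀ n : N, θ' (n : G) = θ n)
    (hr : (Nat.card ↥(N ⊓ Subgroup.centralizer (D : Set G)) : ℂ) /
        (Nat.card ↥(D ⊓ Subgroup.centralizer (D : Set G)) * φ 1) ∉ coeIdeal M)
    {ι : Irr (G ⧸ N) → Irr G} (hι : ∀ η, ∀ g : G, ι η g = θ' g * η (QuotientGroup.mk g))
    {χ : Irr G} {ψ : Irr N} (hψ : bl M ψ = bl M θ) (hχ : resInner χ ψ ≠ 0) :
    ∃ η, bl M (ι η) = bl M χ := by
  by_contra! hne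
  obtain ⟨a, hac, haE, haq, haχ⟩ := exists_regular_center_separating hpM hE h hι χ hne
  have hE0 : 0 < E := by
    obtain ⟨k, -, hk⟩ := hE.exists_eq_pow
    rw [hk]
    exact pow_pos hp.out.pos k
  have hCreg : ∀ x, x ^ E = x → x ∈ Subgroup.centralizer (D : Set G) :=
    fun x hx => hE.mem_centralizer_of_pow_eq hD hDp hx
  obtain ⟨f, hf⟩ := hφ.exists_coeff_eq (fun x => x ∈ N ∧ x ^ E = x) fun x hx => hCreg x hx.2
  obtain ⟨F, hF⟩ := hφ.exists_coeff_eq (fun x => x ∈ N ⊓ Subgroup.centralizer (D : Set G))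
    fun x hx => hx.2
  have hfc := hφ.mem_center hf fun g x => by
    rw [conj_pow_eq_iff, (inferInstance : N.Normal).mem_comm_iff, inv_mul_cancel_left]
  have hfN : ∀ x ∉ N, f.coeff x = 0 := by
    intro x hx
    apply Subtype.ext
    rw [hf, if_neg (fun h1 => hx h1.1)]
    rfl
  set Z := subgroupSum (D ⊓ Subgroup.centralizer (D : Set G)) with hZ
  have haF : ∀ y, (a * F).coeff y ∈ M := by
    refine hφ.coeff_mul_mem_of_omega_cosetPart_mem h hac (fun x hx => ?_) haq hF
    exact haE x fun hxE => hx (hCreg x hxE)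
  have hafZ : ∀ y, (a * f * Z).coeff y ∈ M := by
    intro y
    have h1 : a * f * Z = a * (f * Z - F) + a * F := by
      rw [mul_sub, mul_assoc, sub_add_cancel]
    rw [h1, MonoidAlgebra.coeff_add, Finsupp.add_apply]
    exact add_mem (coeff_mul_mem_of_right a
      (hφ.coeff_mul_subgroupSum_sub_mem hpM hE hD hDp h hr (fun x => (hf x).trans (by congr)) hF) y)
      (haF y)
  have hafc := mul_mem hac hfc
  -- Annihilation by `Z` alone does not force vanishing; the `E`-th power is moreover supported on
  -- regular elements modulo `M`, and each coset of the central `p`-subgroup has at most one of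
  -- these.
  have hafE : ∀ y, ((a * f) ^ E).coeff y ∈ M := by
    refine coeff_mem_of_mul_subgroupSum hE hD hDp (fun x hx => coeff_pow_mem hpM hE hafc x hx) ?_
    intro x
    obtain ⟨k, hk⟩ := Nat.exists_eq_succ_of_ne_zero hE0.ne'
    rw [hk, pow_succ, mul_assoc]
    exact coeff_mul_mem_of_right _ hafZ x
  have h1 := omega_mem_coeIdeal χ (pow_mem hafc E) hafE
  rw [omega_pow χ hafc, omega_mul χ hac hfc] at h1
  have h2 := mem_of_pow_mem_coeIdeal ((isIntegral_omega χ hac).mul (isIntegral_omega χ hfc)) h1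
  have h3 := (mem_or_mem_of_mul_mem_coeIdeal (isIntegral_omega χ hac) (isIntegral_omega χ hfc)
    h2).resolve_left haχ
  -- `ω_χ(f) ∈ M` is now carried to `ψ`, then to `θ` in the same block, where the value is congruent
  -- to the ratio in `hr`.
  rw [omega_restrictCoeff_of_resInner_ne_zero hχ hfc hfN] at h3
  have h4 := omega_sub_mem_of_bl_eq hψ (restrictCoeff_mem_center (N := N) hfc)
  rw [omega_eq_omega_restrictCoeff h hfN] at h4
  have h5 := hφ.sum_regular_sub_mem hpM hE hD hDp h hr (q := (1 : G ⧸ N)) (one_pow E)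
  simp only [QuotientGroup.eq_one_iff] at h5
  have h6 : omega θ' f - (Nat.card ↥(N ⊓ Subgroup.centralizer (D : Set G)) : ℂ) /
      (Nat.card ↥(D ⊓ Subgroup.centralizer (D : Set G)) * φ 1) ∈ coeIdeal M := by
    rw [hφ.omega_eq hf]
    convert h5
  apply hr
  have h7 := sub_mem (sub_mem h3 h4) h6
  rwa [sub_sub_cancel, sub_sub_cancel] at h7

end IsCentralizerCharacter

end Surjectivity

end BlockTheory

/-! ### The bijection of blocks. -/

theorem theorem3p4 (p : ℕ) [Fact p.Prime]
    (M : Ideal AlgInt) (hM : M.IsMaximal) (hpM : (p : AlgInt) ∈ M)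
    {G : Type*} [Group G] [Finite G] (N : Subgroup G) [N.Normal]
    (b : Bl M N) (D : Subgroup N) (hD : IsDefectGroup p b D)
    (hDC : (D.map N.subtype : Set G) *
      (Subgroup.centralizer (D.map N.subtype : Set G) : Set G) = Set.univ)
    (θ : Irr N) (hθ : bl M θ = b)
    (θ' : Irr G) (hext : ∀ n : N, θ' (n : G) = θ n) :
    ∃ υ : Bl M (G ⧸ N) → {B : Bl M G // Covers B b},
      Function.Bijective υ ∧
      ∀ η : Irr (G ⧸ N), ∃ χ : Irr G,
        (∀ g : G, χ g = θ' g * η (QuotientGroup.mk g)) ∧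
        (υ (bl M η) : Bl M G) = bl M χ := by
  classical
  have := Fintype.ofFinite G
  have hMp := hM.isPrime
  have hDN : IsCentralFactor N (D.map N.subtype) := by
    refine ⟨Subgroup.map_subtype_le D, fun g => ?_⟩
    obtain ⟨d, hd, c, hc, h⟩ := Set.mem_mul.mp (hDC ▸ Set.mem_univ g)
    exact ⟨d, hd, c, hc, h.symm⟩
  obtain ⟨E, hE⟩ := exists_isRegularExponent p G
  obtain ⟨φ, hφ⟩ := exists_isCentralizerCharacter hDN hext
  have hr := hφ.card_div_notMem hpM hD hθ hDN hext
  choose f hf using exists_irr_mul θ θ' hext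
  -- Covering is witnessed by `θ` itself, a constituent of the restriction of every `θ'η`.
  let υ : Bl M (G ⧸ N) → {B : Bl M G // Covers B b} :=
    Quotient.lift (fun η => ⟨bl M (f η), f η, θ, rfl, hθ,
      resInner_ne_zero θ θ' hext η (f η) (hf η)⟩) fun η₁ η₂ h =>
        Subtype.ext (bl_mul_eq_of_bl_eq hext (hf η₁) (hf η₂) (Quotient.sound h))
  refine ⟨υ, ⟨?_, ?_⟩, fun η => ⟨f η, hf η, rfl⟩⟩
  · intro B₁ B₂ h
    induction B₁ using Quotient.inductionOn with | _ η₁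
    induction B₂ using Quotient.inductionOn with | _ η₂
    exact hφ.bl_eq_of_bl_mul_eq hpM hE hDN hD.isPGroup hext hr (hf η₁) (hf η₂)
      (congrArg Subtype.val h)
  · rintro ⟨B, χ, ψ, hχ, hψ, hres⟩
    obtain ⟨η, hη⟩ := hφ.exists_bl_mul_eq hpM hE hDN hD.isPGroup hext hr hf
      (hψ.trans hθ.symm) hres
    exact ⟨bl M η, Subtype.ext (hη.trans hχ)⟩
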